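/- **Pooled data problem.** Let $d\ge 1$ be a fixed integer, let $\theta_1,\dots,\theta_d\in(0,1)$, put $\theta=\max_{i}\theta_i$, and let $\delta>0$. For each number $n$ of items let $k_i=\lfloor n^{\theta_i}\rfloor$ ($1\le i\le d$), $k=\max_i k_i=\lfloor n^{\theta}\rfloor$, and let the ground truth $\boldsymbol\sigma$ be uniformly distributed over all vectors in $\{0,1,\dots,d\}^n$ that have exactly $k_i$ coordinates equal to $i$ for every $i=1,\dots,d$ (and hence $n-\sum_i k_i$ coordinates equal to $0$; such vectors exist for all large $n$). A non-adaptive pooling scheme $G$ on $m$ pools consists of $m$ subsets $a_1,\dots,a_m$ of the set of items; its measurement results $\hat{\boldsymbol\sigma}_{G}$ are the label histograms of the pools, i.e. for each pool $a_j$ and each label $\omega\in\{0,\dots,d\}$ the number of items in $a_j$ with label $\omega$. Let $$m_{\mathrm{QGT}}^{\mathrm{inf}}=2\,\frac{1-\theta}{\theta}\,k .$$ Then there exist, for every $n$, a randomised pooling scheme $\mathbf G=\mathbf G_n$, independent of $\boldsymbol\sigma$, on $$m=m(n)\le(1+\delta)\cdot\frac{1+\sqrt\theta}{1-\sqrt\theta}\cdot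 m_{\mathrm{QGT}}^{\mathrm{inf}}$$ pools, and a single deterministic algorithm, whose running time on every pooling scheme with the measurement results of any label vector is bounded by a polynomial in the numbers of items and pools, such that the algorithm, given $\mathbf G$ and $\hat{\boldsymbol\sigma}_{\mathbf G}$, outputs $\boldsymbol\sigma$ with probability tending to $1$ as $n\to\infty$. -/

import Mathlib

open Filter Topology Finset

namespace PooledData

section Model

/-- The number `⌊n ^ θ⌋` of items that carry a label of sparsity exponent `θ`. -/
noncomputable def labelCount (θ : ℝ) (n : ℕ) : ℕ := ⌊(n : ℝ) ^ θ⌋₊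

/-- The possible ground truths on `n` items: all label vectors with labels in `{0, …, d}` in which
every nonzero label `i` occurs exactly `⌊n ^ θᵢ⌋` times (`θs i` is the exponent of label `i + 1`);
all the remaining items carry the label `0`. -/
noncomputable def groundTruths {d : ℕ} (θs : Fin d → ℝ) (n : ℕ) :
    Finset (Fin n → Fin (d + 1)) :=
  {σ | ∀ i : Fin d, #{x | σ x = i.succ} = labelCount (θs i) n}

/-- A (non-adaptive) pooling scheme with `m` pools on `n` items: each pool is a set of items. -/
abbrev PoolingScheme (n m : ℕ) := Fin m → Finset (Fin n)

/-- The measurement results: for each pool `j` the label histogram of the items in the pool. -/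
def measurement {n m d : ℕ} (G : PoolingScheme n m) (σ : Fin n → Fin (d + 1)) :
    Fin m → Fin (d + 1) → ℕ :=
  fun j ω => #{x ∈ G j | σ x = ω}

/-- A decoder maps a pooling scheme and a vector of measurement results to a label vector. -/
abbrev Decoder (d : ℕ) :=
  (n m : ℕ) → PoolingScheme n m → (Fin m → Fin (d + 1) → ℕ) → (Fin n → Fin (d + 1))

/-- The probability that the decoder `A` outputs the ground truth, when the pooling scheme has law
`𝒢` and the ground truth is independent of it and uniform on `groundTruths θs n`. -/
noncomputable def successProb {d : ℕ} (θs : Fin d → ℝ) {n m : ℕ} (𝒢 : PMF (PoolingScheme n m))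
    (A : Decoder d) : ℝ :=
  ∑ G : PoolingScheme n m, (𝒢 G).toReal *
    ((#{σ ∈ groundTruths θs n | A n m G (measurement G σ) = σ} : ℝ) / (#(groundTruths θs n) : ℝ))

/-- The information-theoretic threshold `2 (1 - θ) / θ * k` with `k = ⌊n ^ θ⌋`. -/
noncomputable def mInf (θ : ℝ) (n : ℕ) : ℝ := 2 * ((1 - θ) / θ) * (labelCount θ n : ℝ)

end Model

section Machine

/-! Polynomial time is measured on a random access machine that runs structured programs on an
unbounded memory of natural numbers. Additive operations, tests and memory accesses cost one unit,
multiplications and divisions cost the bit lengths of their operands. So no number ever gets longer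
(in bits) than the numbers in the input and in the program text by more than the elapsed time, and
polynomial time on this machine is polynomial time in the usual sense. -/

/-- The memory: `s a i` is cell `i` of the array `a`. A program mentions only finitely many
arrays. -/
abbrev Mem := ℕ → ℕ → ℕ

/-- Arithmetic expressions. `read a e` is the content of cell `e` of the array `a`; subtraction is
truncated at zero, and division rounds down, with `x / 0 = 0`. -/
inductive Expr where
  | lit (c : ℕ)
  | read (a : ℕ) (e : Expr)
  | add (e f : Expr)
  | sub (e f : Expr)
  | mul (e f : Expr)
  | div (e f : Expr)

/-- The value of an expression. -/
def Expr.eval (s : Mem) : Expr → ℕ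
  | .lit c => c
  | .read a e => s a (e.eval s)
  | .add e f => e.eval s + f.eval s
  | .sub e f => e.eval s - f.eval s
  | .mul e f => e.eval s * f.eval s
  | .div e f => e.eval s / f.eval s

/-- The time needed to evaluate an expression (`Nat.size` is the bit length). -/
def Expr.cost (s : Mem) : Expr → ℕ
  | .lit _ => 1
  | .read _ e => e.cost s + 1
  | .add e f => e.cost s + f.cost s + 1
  | .sub e f => e.cost s + f.cost s + 1
  | .mul e f => e.cost s + f.cost s + (e.eval s).size + (f.eval s).size + 1
  | .div e f => e.cost s + f.cost s + (e.eval s).size + (f.eval s).size + 1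

/-- Programs. `assign a e f` writes the value of `f` into cell `e` of the array `a`; tests succeed
when the value of the expression is nonzero. -/
inductive Prog where
  | skip
  | assign (a : ℕ) (e f : Expr)
  | seq (p q : Prog)
  | ite (e : Expr) (p q : Prog)
  | while (e : Expr) (p : Prog)

/-- `Exec p s s' t`: the program `p`, started on the memory `s`, halts after `t` time units with
the memory `s'`. -/
inductive Exec : Prog → Mem → Mem → ℕ → Prop where
  | skip (s : Mem) : Exec .skip s s 1
  | assign (a : ℕ) (e f : Expr) (s : Mem) :
      Exec (.assign a e f) s
        (Function.update s a (Function.update (s a) (e.eval s) (f.eval s)))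
        (e.cost s + f.cost s + 1)
  | seq {p q : Prog} {s s' s'' : Mem} {t t' : ℕ} :
      Exec p s s' t → Exec q s' s'' t' → Exec (.seq p q) s s'' (t + t')
  | ite_true {e : Expr} {p q : Prog} {s s' : Mem} {t : ℕ} :
      e.eval s ≠ 0 → Exec p s s' t → Exec (.ite e p q) s s' (e.cost s + t + 1)
  | ite_false {e : Expr} {p q : Prog} {s s' : Mem} {t : ℕ} :
      e.eval s = 0 → Exec q s s' t → Exec (.ite e p q) s s' (e.cost s + t + 1)
  | while_true {e : Expr} {p : Prog} {s s' s'' : Mem} {t t' : ℕ} :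
      e.eval s ≠ 0 → Exec p s s' t → Exec (.while e p) s' s'' t' →
        Exec (.while e p) s s'' (e.cost s + t + t' + 1)
  | while_false {e : Expr} {p : Prog} {s : Mem} :
      e.eval s = 0 → Exec (.while e p) s s (e.cost s + 1)

/-- The input of the machine. Array `0` holds `n` and `m`, array `1` the biadjacency matrix of the
pooling scheme (row by row, one row per pool), array `2` the measurement results (row by row, one
histogram per pool); every other cell is `0`. -/
def encode {n m d : ℕ} (G : PoolingScheme n m) (y : Fin m → Fin (d + 1) → ℕ) : Mem
  | 0, 0 => n
  | 0, 1 => m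
  | 1, i => if ∃ j : Fin m, ∃ x : Fin n, x ∈ G j ∧ i = (j : ℕ) * n + (x : ℕ) then 1 else 0
  | 2, i => if h : i / (d + 1) < m then y ⟨i / (d + 1), h⟩ ⟨i % (d + 1), i.mod_lt d.succ_pos⟩ else 0
  | _, _ => 0

/-- The decoder `A` is computed in polynomial time: a single program outputs (in array `3`), for all
numbers of items and of pools, all pooling schemes and the measurement results of all label
vectors, the labels that `A` returns, in a time that is polynomial in the numbers of items and
pools. -/
def PolyTime {d : ℕ} (A : Decoder d) : Prop :=
  ∃ (P : Prog) (c : ℕ), ∀ (n m : ℕ) (G : PoolingScheme n m) (σ : Fin n → Fin (d + 1)),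
    ∃ (s : Mem) (t : ℕ), Exec P (encode G (measurement G σ)) s t ∧ t ≤ c * (n + m + 1) ^ c ∧
      ∀ x : Fin n, s 3 (x : ℕ) = (A n m G (measurement G σ) x : ℕ)

end Machine

end PooledData

/-! The scheme is spatially coupled and the decoder is a weighted threshold test. Items fall
independently and uniformly into `l` blocks. A window is a union of at most `s` consecutive blocks
and carries `M` pools, each containing every item of the window with probability 1/2. Blocks are
decoded in order, and decoded items are subtracted from the measurements. For an item of the current
block, its `c`-th window (`c = 1, …, s`) then holds undecoded items of at most `c` blocks, so its
early windows carry little noise.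

Fix an item `x` and a label `i`. Twice the residual count of `i` in a pool, minus the residual count
in its window, is a sum of independent signs over the undecoded items of label `i`. Multiply it by
the sign of `x` and sum over the pools with weights `w_c`; this is the score (`score_eq`). The
diagonal contributes exactly `M W`, with `W = ∑ w_c`, if `x` has label `i`, and nothing otherwise.
The rest is a Rademacher chaos of variance at most `M κ V`, with `V = ∑ c w_c²`, if no block has
more than `κ ≈ k / l` items of label `i`. By Cauchy–Schwarz `w_c ∝ 1 / c` is optimal, and `W² / V`
becomes a harmonic sum of size about `log s ≈ θ log n` (`log_sub_two_le_weight_ratio`).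

If `M l ≈ (2 r / θ) k`, then `Γ = M W² / (2 κ V)` is about `r log n`. With the threshold at `α M W`,
Hoeffding bounds the expected number of false positives per label by `n exp(-α² Γ)` and of misses by
`k exp(-(1 - α)² Γ)`. Both vanish when `α √r > 1` and `(1 - α) √r > √θ`, which is possible as soon
as `√r > 1 + √θ`. The value `r = (1 + √θ)²` costs `2 (1 + √θ)² k / θ` pools, which is the claimed
number; the slack `δ` absorbs the rest.

The test events are phrased with the residuals of the true labels, so a union bound needs no
conditioning on earlier decisions (`card_decoding_failure_le`). The decoder learns the structure
from the pools: the windows are pools themselves, and the size of the last pool is the number of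
windows. For the running time, the decoder is written in a language of counted loops in which
numbers stay polynomially long (`exec_denote`); loop invariants show what it computes
(`thresholdDecoder_eq`). -/

namespace PooledData

/-! ### Counted-loop programs: semantics, compilation and polynomial time. -/

section ForPrograms

/-- Expressions whose products have a controlled size: one factor is a literal, or a quotient of
the number of items, or the product is of the form `e / f * f`. -/
inductive Expr.Tame : Expr → Prop
  | lit (c : ℕ) : Tame (.lit c)
  | read (a : ℕ) {e : Expr} : Tame e → Tame (.read a e)
  | add {e f : Expr} : Tame e → Tame f → Tame (.add e f)
  | sub {e f : Expr} : Tame e → Tame f → Tame (.sub e f)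
  | div {e f : Expr} : Tame e → Tame f → Tame (.div e f)
  | mulLit (c : ℕ) {e : Expr} : Tame e → Tame (.mul (.lit c) e)
  | mulQuot {e f : Expr} : Tame e → Tame f → Tame (.mul (.div (.read 0 (.lit 0)) e) f)
  | mulDiv {e f : Expr} : Tame e → Tame f → Tame (.mul (.div e f) f)

/-- The weight of an expression, which controls both the size of its value and its cost. -/
def Expr.weight : Expr → ℕ
  | .lit c => c + 1
  | .read _ e => e.weight + 1
  | .add e f => e.weight + f.weight + 1
  | .sub e f => e.weight + f.weight + 1
  | .mul e f => e.weight + f.weight + 5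
  | .div e f => e.weight + f.weight + 5

/-- An admissible product multiplies by a constant or by at most `N`, or does not exceed its
dividend. So the exponent grows additively under repeated assignments, whereas squaring would double
it. -/
theorem Expr.Tame.eval_le {e : Expr} (he : e.Tame) {s : Mem} {N E : ℕ} (hn : s 0 0 ≤ N)
    (hs : ∀ a i, s a i ≤ (N + 2) ^ E) : e.eval s ≤ (N + 2) ^ (E + e.weight) := by
  have mono : ∀ {a b : ℕ}, a ≤ b → (N + 2) ^ a ≤ (N + 2) ^ b := fun h =>
    Nat.pow_le_pow_right (by omega) h
  have hlit : ∀ c : ℕ, c ≤ (N + 2) ^ c := fun c => (Nat.lt_pow_self (by omega)).le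
  have hmul : ∀ {x y a b c : ℕ}, x ≤ (N + 2) ^ a → y ≤ (N + 2) ^ b → a + b ≤ c →
      x * y ≤ (N + 2) ^ c := fun hx hy h =>
    (Nat.mul_le_mul hx hy).trans (by rw [← pow_add]; exact mono h)
  induction he with
  | lit c => exact (hlit c).trans (mono (by simp only [Expr.weight]; omega))
  | read a _ _ => exact (hs _ _).trans (mono (by omega))
  | @add e f _ _ ihe ihf =>
    have h2 : 2 * (N + 2) ^ (E + e.weight + f.weight) ≤ (N + 2) ^ (E + (e.weight + f.weight + 1)) := by
      rw [show E + (e.weight + f.weight + 1) = (E + e.weight + f.weight) + 1 by omega, pow_succ,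
        mul_comm]
      exact Nat.mul_le_mul_left _ (by omega)
    have h3 := ihe.trans (mono (show E + e.weight ≤ E + e.weight + f.weight by omega))
    have h4 := ihf.trans (mono (show E + f.weight ≤ E + e.weight + f.weight by omega))
    simp only [Expr.eval, Expr.weight]
    omega
  | @sub e f _ _ ihe ihf =>
    simp only [Expr.eval, Expr.weight]
    exact (Nat.sub_le _ _).trans (ihe.trans (mono (by omega)))
  | @div e f _ _ ihe ihf =>
    simp only [Expr.eval, Expr.weight]
    exact (Nat.div_le_self _ _).trans (ihe.trans (mono (by omega)))
  | @mulLit c e _ ih =>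
    simp only [Expr.eval, Expr.weight]
    exact hmul (hlit c) ih (by omega)
  | @mulQuot e f _ _ ihe ihf =>
    simp only [Expr.eval, Expr.weight]
    refine hmul (a := 1) ?_ ihf (by omega)
    exact (Nat.div_le_self _ _).trans (by rw [pow_one]; omega)
  | @mulDiv e f _ _ ihe ihf =>
    simp only [Expr.eval, Expr.weight]
    exact (Nat.div_mul_le_self _ _).trans (ihe.trans (mono (by omega)))

/-- The crude estimate `log₂ (N + 2) ≤ N + 2` only costs a polynomial factor. -/
theorem size_le_of_le_pow {N x K : ℕ} (h : x ≤ (N + 2) ^ K) : x.size ≤ (N + 2) * K + 1 := by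
  rw [Nat.size_le]
  calc x ≤ (N + 2) ^ K := h
    _ ≤ (2 ^ (N + 2)) ^ K := Nat.pow_le_pow_left Nat.lt_two_pow_self.le _
    _ = 2 ^ ((N + 2) * K) := by rw [pow_mul]
    _ < _ := Nat.pow_lt_pow_right (by omega) (by omega)

theorem Expr.Tame.of_mul {e f : Expr} (h : (Expr.mul e f).Tame) : e.Tame ∧ f.Tame := by
  cases h with
  | mulLit c h => exact ⟨.lit c, h⟩
  | mulQuot h h' => exact ⟨.div (.read _ (.lit _)) h, h'⟩
  | mulDiv h h' => exact ⟨.div h h', h'⟩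

/-- The time bound for programs of weight `w` that start with values at most `(N + 2) ^ E`. -/
def timeBound (N E w : ℕ) : ℕ := w * ((E + w + 1) * (N + 2))

/-- Sequential composition: a piece of weight `w` raises the exponent of the memory from `E` to `E +
w`. Since `timeBound` contains the weight in its size factor, it absorbs this growth. -/
theorem timeBound_add_le {N E w w' : ℕ} :
    timeBound N E w + timeBound N (E + w) w' ≤ timeBound N E (w + w') := by
  unfold timeBound
  rw [add_mul w w']
  exact add_le_add (Nat.mul_le_mul_left _ (Nat.mul_le_mul_right _ (by omega)))
    (Nat.mul_le_mul_left _ (Nat.mul_le_mul_right _ (by omega)))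

theorem timeBound_mono {N E E' w w' : ℕ} (hE : E ≤ E') (h : w ≤ w') :
    timeBound N E w ≤ timeBound N E' w' := by
  unfold timeBound
  gcongr

theorem le_timeBound {N E w c : ℕ} (h : c ≤ w) : c ≤ timeBound N E w :=
  h.trans (Nat.le_mul_of_pos_right _ (by positivity))

theorem timeBound_combine {N E w w' c : ℕ} :
    timeBound N E w + timeBound N E w' + c ≤ timeBound N E (w + w' + c) := by
  have h1 := @timeBound_add_le N E (w + w') c
  have h2 := @timeBound_add_le N E w w'
  have h3 := @timeBound_mono N E (E + w) w' w' (by omega) le_rfl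
  have h4 := @le_timeBound N (E + (w + w')) c c le_rfl
  omega

theorem timeBound_add_const_le {N E w c : ℕ} :
    timeBound N E w + c ≤ timeBound N E (w + c) := by
  have h1 := @timeBound_add_le N E w c
  have h2 := @le_timeBound N (E + w) c c le_rfl
  omega

theorem Expr.Tame.cost_le {e : Expr} (he : e.Tame) {s : Mem} {N E : ℕ} (hn : s 0 0 ≤ N)
    (hs : ∀ a i, s a i ≤ (N + 2) ^ E) : e.cost s ≤ timeBound N E e.weight := by
  have key : ∀ e f : Expr, e.Tame → f.Tame → e.cost s ≤ timeBound N E e.weight →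
      f.cost s ≤ timeBound N E f.weight →
      e.cost s + f.cost s + (e.eval s).size + (f.eval s).size + 1 ≤
        timeBound N E (e.weight + f.weight + 5) := by
    intro e f he hf ihe ihf
    have h1 := size_le_of_le_pow (he.eval_le hn hs)
    have h2 := size_le_of_le_pow (hf.eval_le hn hs)
    have h3 := @timeBound_combine N E e.weight f.weight 0
    rw [Nat.add_zero, Nat.add_zero] at h3
    have h4 := @timeBound_add_le N E (e.weight + f.weight) 5
    have h5 : (N + 2) * (E + e.weight) + 1 + ((N + 2) * (E + f.weight) + 1) + 1 ≤
        timeBound N (E + (e.weight + f.weight)) 5 := by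
      unfold timeBound
      nlinarith [Nat.zero_le (N * E), Nat.zero_le (N * e.weight), Nat.zero_le (N * f.weight)]
    omega
  induction e with
  | lit c => exact le_timeBound (by simp [Expr.cost, Expr.weight])
  | read a e ih =>
    cases he with
    | read _ he =>
      have := @timeBound_add_const_le N E e.weight 1
      have := ih he
      simp only [Expr.cost, Expr.weight] at *
      omega
  | add e f ihe ihf =>
    cases he with
    | add he hf =>
      have := @timeBound_combine N E e.weight f.weight 1
      have := ihe he
      have := ihf hf
      simp only [Expr.cost, Expr.weight] at *
      omega
  | sub e f ihe ihf =>
    cases he with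
    | sub he hf =>
      have := @timeBound_combine N E e.weight f.weight 1
      have := ihe he
      have := ihf hf
      simp only [Expr.cost, Expr.weight] at *
      omega
  | mul e f ihe ihf =>
    obtain ⟨he, hf⟩ := he.of_mul
    exact key e f he hf (ihe he) (ihf hf)
  | div e f ihe ihf =>
    cases he with
    | div he hf => exact key e f he hf (ihe he) (ihf hf)

/-- Writing one memory cell. -/
def Mem.set (s : Mem) (a i v : ℕ) : Mem := Function.update s a (Function.update (s a) i v)

theorem Mem.set_apply (s : Mem) (a i v a' i' : ℕ) :
    s.set a i v a' i' = if a' = a ∧ i' = i then v else s a' i' := by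
  unfold Mem.set
  by_cases h : a' = a
  · subst h
    by_cases h' : i' = i
    · subst h'; simp
    · simp [h']
  · simp [h]

theorem Mem.set_of_ne (s : Mem) {a a' : ℕ} (i v : ℕ) (h : a' ≠ a) : s.set a i v a' = s a' := by
  simp [Mem.set, h]

/-- Programs all of whose loops are bounded by the number of items (`i = 0`) or the number of
pools (`i = 1`): `loop i v p` runs `p` with the counter `v` equal to `0, 1, …`. -/
inductive ForProg where
  | skip
  | assign (a : ℕ) (e f : Expr)
  | seq (p q : ForProg)
  | ite (e : Expr) (p q : ForProg)
  | loop (i v : ℕ) (p : ForProg)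

namespace ForProg

/-- The current value of the scalar variable `v`, kept in cell `0` of array `v`. -/
abbrev _root_.PooledData.Expr.var (v : ℕ) : Expr := .read v (.lit 0)

/-- Translation to programs of the machine. -/
def compile : ForProg → Prog
  | skip => .skip
  | assign a e f => .assign a e f
  | seq p q => .seq p.compile q.compile
  | ite e p q => .ite e p.compile q.compile
  | loop i v p => .seq (.assign v (.lit 0) (.lit 0))
      (.while (.sub (.read 0 (.lit i)) (.var v))
        (.seq p.compile (.assign v (.lit 0) (.add (.var v) (.lit 1)))))

/-- The function on memories that is computed by a program. -/
def denote : ForProg → Mem → Mem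
  | skip, s => s
  | assign a e f, s => s.set a (e.eval s) (f.eval s)
  | seq p q, s => q.denote (p.denote s)
  | ite e p q, s => if e.eval s ≠ 0 then p.denote s else q.denote s
  | loop i v p, s =>
      (fun s => (p.denote s).set v 0 (p.denote s v 0 + 1))^[s 0 i] (s.set v 0 0)

/-- The program may write to the array `a`. -/
def Writes : ForProg → ℕ → Prop
  | skip, _ => False
  | assign b _ _, a => a = b
  | seq p q, a => p.Writes a ∨ q.Writes a
  | ite _ p q, a => p.Writes a ∨ q.Writes a
  | loop _ v p, a => a = v ∨ p.Writes a

/-- Well-formed programs: expressions are tame, array `0` is never written to, and the counter of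
a loop is not written to in its body. -/
def WellFormed : ForProg → Prop
  | skip => True
  | assign a e f => a ≠ 0 ∧ e.Tame ∧ f.Tame
  | seq p q => p.WellFormed ∧ q.WellFormed
  | ite e p q => e.Tame ∧ p.WellFormed ∧ q.WellFormed
  | loop i v p => i < 2 ∧ v ≠ 0 ∧ ¬ p.Writes v ∧ p.WellFormed

/-- The weight of a program, given a bound on the numbers of items and pools. -/
def weight : ForProg → ℕ → ℕ
  | skip, _ => 1
  | assign _ e f, _ => e.weight + f.weight + 1
  | seq p q, N => p.weight N + q.weight N
  | ite e p q, N => e.weight + (p.weight N + q.weight N) + 1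
  | loop i _ p, N => 10 + i + N * (p.weight N + (i + 20))

/-- Frame rule; it keeps loop bounds and counters fixed while bodies run. -/
theorem denote_of_not_writes {p : ForProg} {a : ℕ} (h : ¬ p.Writes a) (s : Mem) :
    p.denote s a = s a := by
  induction p generalizing s with
  | skip => rfl
  | assign b e f => exact Mem.set_of_ne _ _ _ h
  | seq p q ihp ihq =>
    simp only [Writes, not_or] at h
    simp only [denote, ihq h.2, ihp h.1]
  | ite e p q ihp ihq =>
    simp only [Writes, not_or] at h
    simp only [denote]
    split_ifs
    · exact ihp h.1 s
    · exact ihq h.2 s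
  | loop i v p ih =>
    simp only [Writes, not_or] at h
    simp only [denote]
    generalize s 0 i = k
    induction k with
    | zero => exact Mem.set_of_ne _ _ _ h.1
    | succ k ihk => rw [Function.iterate_succ_apply', Mem.set_of_ne _ _ _ h.1, ih h.2, ihk]

theorem WellFormed.not_writes_zero {p : ForProg} (h : p.WellFormed) : ¬ p.Writes 0 := by
  induction p with
  | skip => exact id
  | assign b e f => exact fun h' => h.1 h'.symm
  | seq p q ihp ihq => exact fun h' => h'.elim (ihp h.1) (ihq h.2)
  | ite e p q ihp ihq => exact fun h' => h'.elim (ihp h.2.1) (ihq h.2.2)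
  | loop i v p ih => exact fun h' => h'.elim (fun h' => h.2.1 h'.symm) (ih h.2.2.2)

/-- The body of a loop, followed by the increment of the counter. -/
def step (v : ℕ) (p : ForProg) (s : Mem) : Mem := (p.denote s).set v 0 (p.denote s v 0 + 1)

theorem denote_loop (i v : ℕ) (p : ForProg) (s : Mem) :
    (loop i v p).denote s = (step v p)^[s 0 i] (s.set v 0 0) := rfl

/-- Time and size are bounded in one induction, because the cost of a second program depends on how
large the values are that the first one leaves behind. For the same reason `E` is generalized. -/
theorem exec_denote {p : ForProg} (hp : p.WellFormed) (N E : ℕ) (s : Mem) (h0 : s 0 0 ≤ N)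
    (h1 : s 0 1 ≤ N) (hs : ∀ a i, s a i ≤ (N + 2) ^ E) :
    (∃ t, Exec p.compile s (p.denote s) t ∧ t ≤ timeBound N E (p.weight N)) ∧
      ∀ a i, p.denote s a i ≤ (N + 2) ^ (E + p.weight N) := by
  have mono : ∀ {a b : ℕ}, a ≤ b → (N + 2) ^ a ≤ (N + 2) ^ b := fun h =>
    Nat.pow_le_pow_right (by omega) h
  induction p generalizing s E with
  | skip => exact ⟨⟨1, .skip s, le_timeBound le_rfl⟩, fun a i => (hs a i).trans (mono (by omega))⟩
  | assign a e f =>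
    obtain ⟨_, he, hf⟩ := hp
    refine ⟨⟨_, .assign a e f s, ?_⟩, fun b i => ?_⟩
    · have := he.cost_le h0 hs
      have := hf.cost_le h0 hs
      have := @timeBound_combine N E e.weight f.weight 1
      simp only [weight]
      omega
    · simp only [denote, Mem.set_apply, weight]
      split_ifs
      · exact (hf.eval_le h0 hs).trans (mono (by omega))
      · exact (hs b i).trans (mono (by omega))
  | seq p q ihp ihq =>
    obtain ⟨⟨t, ht, ht'⟩, hb⟩ := ihp hp.1 E s h0 h1 hs
    have hz := denote_of_not_writes hp.1.not_writes_zero s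
    obtain ⟨⟨t', hq, hq'⟩, hb'⟩ := ihq hp.2 (E + p.weight N) (p.denote s) (by rw [hz]; exact h0)
      (by rw [hz]; exact h1) hb
    refine ⟨⟨_, .seq ht hq, ?_⟩, fun a i => ?_⟩
    · exact (add_le_add ht' hq').trans timeBound_add_le
    · simpa only [weight, denote, add_assoc] using hb' a i
  | ite e p q ihp ihq =>
    obtain ⟨he, hp, hq⟩ := hp
    have hc := he.cost_le h0 hs
    simp only [denote, weight]
    have h3 := @timeBound_combine N E e.weight (p.weight N + q.weight N) 1
    split_ifs with h
    · obtain ⟨⟨t, ht, ht'⟩, hb⟩ := ihp hp E s h0 h1 hs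
      have h4 := @timeBound_mono N E E (p.weight N) (p.weight N + q.weight N) le_rfl (by omega)
      exact ⟨⟨_, .ite_true h ht, by omega⟩, fun a i => (hb a i).trans (mono (by omega))⟩
    · obtain ⟨⟨t, ht, ht'⟩, hb⟩ := ihq hq E s h0 h1 hs
      have h4 := @timeBound_mono N E E (q.weight N) (p.weight N + q.weight N) le_rfl (by omega)
      exact ⟨⟨_, .ite_false (not_not.1 h) ht, by omega⟩, fun a i => (hb a i).trans (mono (by omega))⟩
  | loop i v p ih =>
    obtain ⟨hi, hv, hw, hp⟩ := hp
    have hz := hp.not_writes_zero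
    have hiN : s 0 i ≤ N := by
      interval_cases i
      exacts [h0, h1]
    set c : Expr := .sub (.read 0 (.lit i)) (.var v) with hc
    set inc : ForProg := .assign v (.lit 0) (.add (.var v) (.lit 1)) with hinc
    have hct : c.Tame := .sub (.read _ (.lit _)) (.read _ (.lit _))
    have hcw : c.weight = i + 5 := by simp [hc, Expr.weight]
    -- Here `k` counts the remaining rounds. A round raises the exponent by `p.weight N + 1`, the
    -- extra one being for the counter; the larger constant `i + 20` also covers the cost of the
    -- test.
    have key : ∀ k E s, s 0 0 ≤ N → s 0 1 ≤ N → (∀ a i, s a i ≤ (N + 2) ^ E) →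
        s v 0 + k = s 0 i →
        (∃ t, Exec (.while c (.seq p.compile inc.compile)) s ((step v p)^[k] s) t ∧
          t ≤ timeBound N E (k * (p.weight N + (i + 20)) + (i + 6))) ∧
        ∀ a j, (step v p)^[k] s a j ≤ (N + 2) ^ (E + k * (p.weight N + (i + 20))) := by
      intro k
      induction k with
      | zero =>
        intro E s h0 h1 hs hk
        refine ⟨⟨_, .while_false (by simp only [hc, Expr.eval]; omega), ?_⟩, by simpa using hs⟩
        have := hct.cost_le h0 hs
        have := @timeBound_add_const_le N E c.weight 1
        rw [zero_mul, zero_add, show i + 6 = c.weight + 1 by omega]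
        omega
      | succ k ihk =>
        intro E s h0 h1 hs hk
        obtain ⟨⟨t, ht, ht'⟩, hb⟩ := ih hp E s h0 h1 hs
        have hz0 := denote_of_not_writes hz s
        have hzv := denote_of_not_writes hw s
        have hs0 : step v p s 0 = s 0 := by
          rw [step, Mem.set_of_ne _ _ _ hv.symm, hz0]
        have hsv : step v p s v 0 = s v 0 + 1 := by
          rw [step, Mem.set_apply, hzv]; simp
        have hstep : ∀ a j, step v p s a j ≤ (N + 2) ^ (E + (p.weight N + 1)) := by
          have hpos : 0 < (N + 2) ^ (E + p.weight N) := by positivity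
          have h2 : 2 * (N + 2) ^ (E + p.weight N) ≤ (N + 2) ^ (E + (p.weight N + 1)) := by
            rw [← add_assoc, pow_succ, mul_comm]
            exact Nat.mul_le_mul_left _ (by omega)
          intro a j
          rw [step, Mem.set_apply]
          have := hb a j
          have := hb v 0
          split_ifs <;> omega
        obtain ⟨⟨t', ht2, ht2'⟩, hb2⟩ := ihk (E + (p.weight N + 1)) (step v p s) (by rw [hs0]; exact h0)
          (by rw [hs0]; exact h1) hstep (by rw [hs0, hsv]; omega)
        have hne : c.eval s ≠ 0 := by simp only [hc, Expr.eval]; omega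
        have hexi : Exec inc.compile (p.denote s) (step v p s) _ := Exec.assign _ _ _ _
        refine ⟨⟨_, .while_true hne (.seq ht hexi) ht2, ?_⟩, fun a j => ?_⟩
        · have e1 := hct.cost_le h0 hs
          have e3 : (Expr.lit 0).cost (p.denote s) +
            (Expr.add (.var v) (.lit 1)).cost (p.denote s) + 1 = 6 := rfl
          have e5 := @timeBound_combine N E c.weight (p.weight N) 7
          rw [hcw] at e1 e5
          have e6 := @timeBound_mono N (E + (p.weight N + 1)) (E + (i + 5 + p.weight N + 7))
            (k * (p.weight N + (i + 20)) + (i + 6)) _ (by omega) le_rfl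
          have e7 := @timeBound_add_le N E (i + 5 + p.weight N + 7)
            (k * (p.weight N + (i + 20)) + (i + 6))
          have e8 := @timeBound_mono N E E (i + 5 + p.weight N + 7 +
            (k * (p.weight N + (i + 20)) + (i + 6)))
            ((k + 1) * (p.weight N + (i + 20)) + (i + 6)) le_rfl (by rw [add_mul]; omega)
          rw [show E + (p.weight N + 1) = E + p.weight N + 1 by omega] at *
          omega
        · rw [Function.iterate_succ_apply]
          refine (hb2 a j).trans (mono ?_)
          rw [add_mul]; omega
    have hset : ∀ a j, s.set v 0 0 a j ≤ (N + 2) ^ E := by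
      intro a j
      rw [Mem.set_apply]
      split_ifs
      · omega
      · exact hs a j
    have hset0 : s.set v 0 0 0 = s 0 := Mem.set_of_ne _ _ _ hv.symm
    obtain ⟨⟨t, ht, ht'⟩, hb⟩ := key (s 0 i) E (s.set v 0 0) (by rw [hset0]; exact h0)
      (by rw [hset0]; exact h1) hset (by rw [hset0, Mem.set_apply]; simp)
    refine ⟨⟨_, .seq (.assign _ _ _ _) ht, ?_⟩, fun a j => ?_⟩
    · have e1 : (Expr.lit 0).cost s + (Expr.lit 0).cost s + 1 = 3 := rfl
      have e2 := @timeBound_combine N E 0 (s 0 i * (p.weight N + (i + 20)) + (i + 6)) 3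
      have e3 := @timeBound_mono N E E (0 + (s 0 i * (p.weight N + (i + 20)) + (i + 6)) + 3)
        ((loop i v p).weight N) le_rfl (by
          have := Nat.mul_le_mul_right (p.weight N + (i + 20)) hiN
          simp only [weight]; omega)
      omega
    · refine (hb a j).trans (mono ?_)
      have := Nat.mul_le_mul_right (p.weight N + (i + 20)) hiN
      simp only [weight]; omega

/-- Each loop contributes one factor `N`, and the nesting depth is fixed by the program text. -/
theorem exists_weight_le (p : ForProg) : ∃ c, ∀ N, p.weight N ≤ c * (N + 1) ^ c := by
  have hpow : ∀ {N a b : ℕ}, a ≤ b → (N + 1) ^ a ≤ (N + 1) ^ b := fun h =>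
    Nat.pow_le_pow_right (by omega) h
  have lift : ∀ {N w c C : ℕ}, w ≤ c * (N + 1) ^ c → c ≤ C → w ≤ c * (N + 1) ^ C :=
    fun h hc => h.trans (Nat.mul_le_mul_left _ (hpow hc))
  have one : ∀ N C : ℕ, 1 ≤ (N + 1) ^ C := fun N C => Nat.one_le_pow _ _ (by omega)
  induction p with
  | skip => exact ⟨1, fun N => by simp [weight]⟩
  | assign a e f =>
    exact ⟨e.weight + f.weight + 1, fun N => Nat.le_mul_of_pos_right _ (one _ _)⟩
  | seq p q ihp ihq =>
    obtain ⟨c, hc⟩ := ihp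
    obtain ⟨c', hc'⟩ := ihq
    refine ⟨c + c', fun N => ?_⟩
    have h1 := lift (hc N) (show c ≤ c + c' by omega)
    have h2 := lift (hc' N) (show c' ≤ c + c' by omega)
    simp only [weight, add_mul c c']
    omega
  | ite e p q ihp ihq =>
    obtain ⟨c, hc⟩ := ihp
    obtain ⟨c', hc'⟩ := ihq
    refine ⟨c + c' + (e.weight + 1), fun N => ?_⟩
    have h1 := lift (hc N) (show c ≤ c + c' + (e.weight + 1) by omega)
    have h2 := lift (hc' N) (show c' ≤ c + c' + (e.weight + 1) by omega)
    have h3 := Nat.mul_le_mul_left (e.weight + 1) (one N (c + c' + (e.weight + 1)))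
    simp only [weight, add_mul (c + c'), add_mul c c']
    omega
  | loop i v p ih =>
    obtain ⟨c, hc⟩ := ih
    refine ⟨c + (2 * i + 30), fun N => ?_⟩
    have h1 := lift (hc N) (show c ≤ c + (2 * i + 29) by omega)
    have h2 := one N (c + (2 * i + 29))
    set Q := (N + 1) ^ (c + (2 * i + 29)) with hQ
    have h3 : (N + 1) ^ (c + (2 * i + 30)) = (N + 1) * Q := by
      rw [hQ, ← pow_succ']; rfl
    rw [h3]
    have h4 : p.weight N + (i + 20) ≤ (c + (i + 20)) * Q := by
      rw [add_mul]
      have := Nat.mul_le_mul_left (i + 20) h2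
      omega
    have h5 := Nat.mul_le_mul_left N h4
    have h6 : 10 + i ≤ (10 + i) * Q := Nat.le_mul_of_pos_right _ h2
    calc (loop i v p).weight N = 10 + i + N * (p.weight N + (i + 20)) := rfl
      _ ≤ (10 + i) * Q + N * ((c + (i + 20)) * Q) := by omega
      _ ≤ (c + (2 * i + 30)) * ((N + 1) * Q) := by
          nlinarith [Nat.zero_le (N * Q), Nat.zero_le (N * Q * i), Nat.zero_le (c * Q),
            Nat.zero_le (i * Q)]

/-- Well-formed programs run in polynomial time on memories with entries at most `N + 2`, when `N`
bounds the numbers of items and pools. -/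
theorem exists_polyTime {p : ForProg} (hp : p.WellFormed) : ∃ c, ∀ (N : ℕ) (s : Mem),
    s 0 0 ≤ N → s 0 1 ≤ N → (∀ a i, s a i ≤ N + 2) →
      ∃ t, Exec p.compile s (p.denote s) t ∧ t ≤ c * (N + 1) ^ c := by
  obtain ⟨c, hc⟩ := p.exists_weight_le
  -- `timeBound` is quadratic in the weight and linear in `N + 2`, whence the exponent `2 * c + 1`;
  -- coefficient and exponent are added because one constant serves as both.
  refine ⟨2 * c * (c + 2) + (2 * c + 1), fun N s h0 h1 hs => ?_⟩
  obtain ⟨⟨t, ht, ht'⟩, -⟩ := exec_denote hp N 1 s h0 h1 (by simpa using hs)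
  refine ⟨t, ht, ht'.trans ?_⟩
  have one : 1 ≤ (N + 1) ^ c := Nat.one_le_pow _ _ (by omega)
  calc timeBound N 1 (p.weight N) ≤ timeBound N 1 (c * (N + 1) ^ c) := timeBound_mono le_rfl (hc N)
    _ = c * (N + 1) ^ c * ((1 + c * (N + 1) ^ c + 1) * (N + 2)) := rfl
    _ ≤ c * (N + 1) ^ c * (((c + 2) * (N + 1) ^ c) * (2 * (N + 1))) := by
      gcongr
      · nlinarith
      · omega
    _ = 2 * c * (c + 2) * (N + 1) ^ (2 * c + 1) := by ring
    _ ≤ _ := Nat.mul_le_mul (by omega) (Nat.pow_le_pow_right (by omega) (by omega))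

/-- The Hoare rule for counted loops. The invariant must also survive the reset and the increments
of the counter, hence the `set` in both premises. -/
theorem loop_induction {i v : ℕ} {p : ForProg} (hv : ¬ p.Writes v) {s : Mem}
    (I : ℕ → Mem → Prop) (h0 : I 0 (s.set v 0 0))
    (hstep : ∀ k < s 0 i, ∀ s', I k s' → s' v 0 = k → I (k + 1) ((p.denote s').set v 0 (k + 1))) :
    I (s 0 i) ((loop i v p).denote s) := by
  have key : ∀ k ≤ s 0 i, I k ((step v p)^[k] (s.set v 0 0)) ∧
      (step v p)^[k] (s.set v 0 0) v 0 = k := by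
    intro k
    induction k with
    | zero => exact fun _ => ⟨h0, by simp [Mem.set_apply]⟩
    | succ k ih =>
      intro hk
      obtain ⟨h1, h2⟩ := ih (by omega)
      rw [Function.iterate_succ_apply']
      have h3 : step v p ((step v p)^[k] (s.set v 0 0)) =
          (p.denote ((step v p)^[k] (s.set v 0 0))).set v 0 (k + 1) := by
        rw [step, denote_of_not_writes hv, h2]
      rw [h3]
      exact ⟨hstep k hk _ h1 h2, by simp [Mem.set_apply]⟩
  rw [denote_loop]
  exact (key _ le_rfl).1

theorem denote_seq (p q : ForProg) (s : Mem) : (seq p q).denote s = q.denote (p.denote s) := rfl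

theorem denote_assign (a : ℕ) (e f : Expr) (s : Mem) :
    (assign a e f).denote s = s.set a (e.eval s) (f.eval s) := rfl

theorem denote_ite_of_ne {e : Expr} {s : Mem} (h : e.eval s ≠ 0) (p q : ForProg) :
    (ite e p q).denote s = p.denote s := if_pos h

theorem denote_ite_of_eq {e : Expr} {s : Mem} (h : e.eval s = 0) (p q : ForProg) :
    (ite e p q).denote s = q.denote s := if_neg (not_not.2 h)

end ForProg

end ForPrograms

/-! ### The decoder as a program. -/

section Decoder

open ForProg

/-- The entry of the pooling matrix for the pool `j` and the item `x`. -/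
def matE (j x : Expr) : Expr :=
  .read 1 (.add (.mul (.div (.read 0 (.lit 0)) (.lit 1)) j) x)

/-- The residual number of items with label `i` in the pool `j`. -/
def resE (d : ℕ) (j i : Expr) : Expr := .read 2 (.add (.mul (.lit (d + 1)) j) i)

/-- The index of the header pool of the pool `j`: `j % T`. -/
def headE : Expr := .sub (.var 8) (.mul (.div (.var 8) (.var 5)) (.var 5))

/-- The product of the weight `n / (j % T + 1 - b)` with `e`. -/
def weightE (e : Expr) : Expr :=
  .mul (.div (.read 0 (.lit 0)) (.sub (.add headE (.lit 1)) (.var 6))) e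

/-- Add the value of `e` to the scalar `v`. -/
def addTo (v : ℕ) (e : Expr) : ForProg := .assign v (.lit 0) (.add (.var v) e)

/-- Add the contribution of one pool to the score of the current item for the label `i`. -/
def scoreBody (d i : ℕ) : ForProg :=
  .ite (.sub (.add (.var 8) (.lit 1)) (.var 5))
    (.ite (.sub (.sub (.read 0 (.lit 1)) (.lit 1)) (.var 8))
      (.ite (matE headE (.var 7))
        (.seq (.ite (matE (.var 8) (.var 7))
          (.seq (addTo 9 (weightE (.mul (.lit 2) (resE d (.var 8) (.lit i)))))
            (addTo 10 (weightE (resE d headE (.lit i)))))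
          (.seq (addTo 9 (weightE (resE d headE (.lit i))))
            (addTo 10 (weightE (.mul (.lit 2) (resE d (.var 8) (.lit i)))))))
          (addTo 11 (weightE (.lit 1))))
        .skip) .skip) .skip

/-- Decide whether the current item has the label `i`. -/
def labelTest (d p q i : ℕ) : ForProg :=
  .seq (.seq (.assign 9 (.lit 0) (.lit 0))
    (.seq (.assign 10 (.lit 0) (.lit 0)) (.assign 11 (.lit 0) (.lit 0))))
  (.seq (.loop 1 8 (scoreBody d i))
    (.ite (.sub (.mul (.lit q) (.var 9)) (.add (.mul (.lit q) (.var 10)) (.mul (.lit p) (.var 11))))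
      (.assign 3 (.var 7) (.lit i)) .skip))

/-- Run the tests for the labels `1, …, i`. -/
def labelTests (d p q : ℕ) : ℕ → ForProg
  | 0 => .skip
  | i + 1 => .seq (labelTests d p q i) (labelTest d p q (i + 1))

/-- Remove the current item, with its decoded label, from the measurement results. -/
def removeBody (d : ℕ) : ForProg :=
  .ite (matE (.var 8) (.var 7))
    (.assign 2 (.add (.mul (.lit (d + 1)) (.var 8)) (.read 3 (.var 7)))
      (.sub (resE d (.var 8) (.read 3 (.var 7))) (.lit 1)))
    .skip

/-- Decode the current item. -/
def decodeItem (d p q : ℕ) : ForProg :=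
  .seq (labelTests d p q d)
    (.seq (.assign 4 (.var 7) (.lit 1)) (.loop 1 8 (removeBody d)))

/-- Decode the current item if it belongs to the current header pool and is not yet decoded. -/
def visitItem (d p q : ℕ) : ForProg :=
  .ite (.sub (matE (.var 6) (.var 7)) (.read 4 (.var 7))) (decodeItem d p q) .skip

/-- Read off the number `T` of header pools. -/
def countHeaders : ForProg :=
  .loop 0 7 (addTo 5 (matE (.sub (.read 0 (.lit 1)) (.lit 1)) (.var 7)))

/-- Replace all outputs above `d` by `d`. -/
def clampOutput (d : ℕ) : ForProg :=
  .loop 0 7 (.assign 3 (.var 7) (.sub (.read 3 (.var 7)) (.sub (.read 3 (.var 7)) (.lit d))))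

/-- The sequential threshold decoder with threshold `p / q`. -/
def decoderProg (d p q : ℕ) : ForProg :=
  .seq (.seq countHeaders (.loop 1 6 (.loop 0 7 (visitItem d p q)))) (clampOutput d)

/-- The division by 1 in `matE` only serves to bring `n * j` into the shape `mulQuot`. Likewise
`headE` computes a remainder through `mulDiv`, and the weights in `weightE` are quotients of `n`. -/
theorem matE_tame {j x : Expr} (hj : j.Tame) (hx : x.Tame) : (matE j x).Tame :=
  .read _ (.add (.mulQuot (.lit _) hj) hx)

theorem resE_tame (d : ℕ) {j i : Expr} (hj : j.Tame) (hi : i.Tame) : (resE d j i).Tame :=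
  .read _ (.add (.mulLit _ hj) hi)

theorem var_tame (v : ℕ) : (Expr.var v).Tame := .read _ (.lit _)

theorem headE_tame : headE.Tame := .sub (var_tame 8) (.mulDiv (var_tame 8) (var_tame 5))

theorem weightE_tame {e : Expr} (he : e.Tame) : (weightE e).Tame :=
  .mulQuot (.sub (.add headE_tame (.lit _)) (var_tame 6)) he

theorem addTo_wellFormed {v : ℕ} {e : Expr} (hv : v ≠ 0) (he : e.Tame) :
    (addTo v e).WellFormed := ⟨hv, .lit _, .add (var_tame v) he⟩

theorem addTo_writes {v : ℕ} {e : Expr} {a : ℕ} : (addTo v e).Writes a ↔ a = v := Iff.rfl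

theorem scoreBody_writes {d i a : ℕ} (h : (scoreBody d i).Writes a) : 9 ≤ a ∧ a ≤ 11 := by
  simp only [scoreBody, Writes, addTo_writes, or_false] at h
  omega

theorem scoreBody_wellFormed (d i : ℕ) : (scoreBody d i).WellFormed := by
  have h1 := resE_tame d (var_tame 8) (.lit i)
  have h2 := resE_tame d headE_tame (.lit i)
  have h3 := weightE_tame (.mulLit 2 h1)
  have h4 := weightE_tame h2
  exact ⟨.sub (.add (var_tame 8) (.lit _)) (var_tame 5),
    ⟨.sub (.sub (.read _ (.lit _)) (.lit _)) (var_tame 8),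
      ⟨matE_tame headE_tame (var_tame 7),
        ⟨⟨matE_tame (var_tame 8) (var_tame 7),
          ⟨addTo_wellFormed (by decide) h3, addTo_wellFormed (by decide) h4⟩,
          ⟨addTo_wellFormed (by decide) h4, addTo_wellFormed (by decide) h3⟩⟩,
        addTo_wellFormed (by decide) (weightE_tame (.lit 1))⟩, trivial⟩, trivial⟩, trivial⟩

theorem labelTest_writes {d p q i a : ℕ} (h : (labelTest d p q i).Writes a) :
    a = 3 ∨ 8 ≤ a ∧ a ≤ 11 := by
  simp only [labelTest, Writes, or_false] at h
  rcases h with h | (h | h) | h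
  · omega
  · omega
  · have := scoreBody_writes h; omega
  · omega

theorem labelTest_wellFormed (d p q i : ℕ) : (labelTest d p q i).WellFormed :=
  ⟨⟨⟨by decide, .lit _, .lit _⟩, ⟨by decide, .lit _, .lit _⟩, ⟨by decide, .lit _, .lit _⟩⟩,
    ⟨by decide, by decide, fun h => by have := scoreBody_writes h; omega, scoreBody_wellFormed d i⟩,
    .sub (.mulLit _ (var_tame _)) (.add (.mulLit _ (var_tame _)) (.mulLit _ (var_tame _))),
    ⟨by decide, var_tame _, .lit _⟩, trivial⟩

theorem labelTests_writes {d p q i a : ℕ} (h : (labelTests d p q i).Writes a) :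
    a = 3 ∨ 8 ≤ a ∧ a ≤ 11 := by
  induction i with
  | zero => exact h.elim
  | succ i ih => exact h.elim ih labelTest_writes

theorem labelTests_wellFormed (d p q i : ℕ) : (labelTests d p q i).WellFormed := by
  induction i with
  | zero => trivial
  | succ i ih => exact ⟨ih, labelTest_wellFormed d p q _⟩

theorem decodeItem_writes {d p q a : ℕ} (h : (decodeItem d p q).Writes a) :
    2 ≤ a ∧ a ≤ 4 ∨ 8 ≤ a ∧ a ≤ 11 := by
  simp only [decodeItem, removeBody, Writes, or_false] at h
  rcases h with h | h
  · have := labelTests_writes h; omega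
  · omega

theorem visitItem_writes {d p q a : ℕ} (h : (visitItem d p q).Writes a) :
    2 ≤ a ∧ a ≤ 4 ∨ 8 ≤ a ∧ a ≤ 11 := h.elim decodeItem_writes False.elim

theorem decoderProg_wellFormed (d p q : ℕ) : (decoderProg d p q).WellFormed := by
  have h3 : (Expr.read 3 (.var 7)).Tame := .read _ (var_tame 7)
  have hm := matE_tame (var_tame 8) (var_tame 7)
  refine ⟨⟨⟨by decide, by decide, by simp [addTo_writes], addTo_wellFormed (by decide)
      (matE_tame (.sub (.read _ (.lit _)) (.lit _)) (var_tame 7))⟩,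
    by decide, by decide, ?_, by decide, by decide, ?_,
    .sub (matE_tame (var_tame 6) (var_tame 7)) (.read _ (var_tame 7)),
    ⟨labelTests_wellFormed d p q d, ⟨by decide, var_tame _, .lit _⟩, by decide, by decide, ?_, hm,
      ⟨by decide, .add (.mulLit _ (var_tame _)) h3, .sub (resE_tame d (var_tame _) h3) (.lit _)⟩,
      trivial⟩, trivial⟩,
    by decide, by decide, ?_, by decide, var_tame _, .sub h3 (.sub h3 (.lit _))⟩
  · rintro (h | h)
    · exact absurd h (by decide)
    · have := visitItem_writes h; omega
  · intro h
    have := visitItem_writes h; omega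
  · simp [removeBody, Writes]
  · simp [Writes]

end Decoder

/-! ### What the program computes: invariants of its loops. -/

section Correctness

open ForProg

variable {n m d p q T : ℕ}

/-- The residual histograms, when the items in `D` have been removed. -/
noncomputable def residual (n : ℕ) (g : ℕ → ℕ → Prop) (lab : ℕ → ℕ) (D : ℕ → Prop) (j ω : ℕ) : ℕ :=
  open Classical in #{y ∈ range n | g j y ∧ ¬ D y ∧ lab y = ω}

/-- The pool `j` contributes to the score of the item `x`. -/
def Relevant (m T : ℕ) (g : ℕ → ℕ → Prop) (x j : ℕ) : Prop :=
  T ≤ j ∧ j + 1 < m ∧ g (j % T) x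

/-- The positive part of the score contributed by the pool `j`. -/
noncomputable def posTerm (n m T : ℕ) (g : ℕ → ℕ → Prop) (R : ℕ → ℕ → ℕ) (b x i j : ℕ) : ℕ :=
  open Classical in
  if Relevant m T g x j then
    n / (j % T + 1 - b) * if g j x then 2 * R j i else R (j % T) i
  else 0

/-- The negative part of the score contributed by the pool `j`. -/
noncomputable def negTerm (n m T : ℕ) (g : ℕ → ℕ → Prop) (R : ℕ → ℕ → ℕ) (b x i j : ℕ) : ℕ :=
  open Classical in
  if Relevant m T g x j then
    n / (j % T + 1 - b) * if g j x then R (j % T) i else 2 * R j i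
  else 0

/-- The weight of the pool `j`. -/
noncomputable def totTerm (n m T : ℕ) (g : ℕ → ℕ → Prop) (b x j : ℕ) : ℕ :=
  open Classical in
  if Relevant m T g x j then n / (j % T + 1 - b) else 0

/-- The score of the item `x` for the label `i` exceeds the threshold. -/
def Accepts (n m T p q : ℕ) (g : ℕ → ℕ → Prop) (R : ℕ → ℕ → ℕ) (b x i : ℕ) : Prop :=
  q * ∑ j ∈ range m, negTerm n m T g R b x i j + p * ∑ j ∈ range m, totTerm n m T g b x j <
    q * ∑ j ∈ range m, posTerm n m T g R b x i j

/-- The items that have been decoded before the item `x` is visited in phase `b`. -/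
def Decoded (g : ℕ → ℕ → Prop) (b x y : ℕ) : Prop :=
  (∃ b' < b, g b' y) ∨ g b y ∧ y < x

open Classical in
/-- The part of the memory that describes the input and the residual measurements. -/
structure ScoreState (n m d T : ℕ) (g : ℕ → ℕ → Prop) (R : ℕ → ℕ → ℕ) (s : Mem) : Prop where
  items : s 0 0 = n
  pools : s 0 1 = m
  matrix : ∀ j x, x < n → s 1 (n * j + x) = if g j x then 1 else 0
  headers : s 5 0 = T
  res : ∀ j < m, ∀ ω ≤ d, s 2 ((d + 1) * j + ω) = R j ω

theorem ScoreState.congr {g : ℕ → ℕ → Prop} {R : ℕ → ℕ → ℕ} {s s' : Mem}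
    (h : ScoreState n m d T g R s) (h0 : s' 0 = s 0) (h1 : s' 1 = s 1) (h2 : s' 2 = s 2)
    (h5 : s' 5 = s 5) : ScoreState n m d T g R s' :=
  ⟨by rw [h0, h.items], by rw [h0, h.pools], by rw [h1]; exact h.matrix, by rw [h5, h.headers],
    by rw [h2]; exact h.res⟩

theorem ScoreState.matE {g : ℕ → ℕ → Prop} {R : ℕ → ℕ → ℕ} {s : Mem} [∀ j x, Decidable (g j x)]
    (h : ScoreState n m d T g R s) (e f : Expr) (hf : f.eval s < n) :
    (matE e f).eval s = if g (e.eval s) (f.eval s) then 1 else 0 := by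
  simp only [PooledData.matE, Expr.eval, h.items, Nat.div_one]
  rw [h.matrix _ _ hf]
  split_ifs <;> rfl

theorem ScoreState.headE {g : ℕ → ℕ → Prop} {R : ℕ → ℕ → ℕ} {s : Mem}
    (h : ScoreState n m d T g R s) : headE.eval s = s 8 0 % T := by
  simp only [PooledData.headE, Expr.eval, h.headers]
  rw [Nat.mod_eq_sub_div_mul]

/-- Machine subtraction truncates at zero, so the positive and negative parts of the score are
accumulated separately in the variables 9 and 10; variable 11 collects the total weight, which
scales the threshold. The two outer tests exclude the header pools and the last pool. -/
theorem ScoreState.scoreBody {g : ℕ → ℕ → Prop} {R : ℕ → ℕ → ℕ} {s : Mem} {b x i j : ℕ}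
    (h : ScoreState n m d T g R s) (h6 : s 6 0 = b) (h7 : s 7 0 = x) (hx : x < n) (hi : i ≤ d)
    (h8 : s 8 0 = j) (hj : j < m) :
    (scoreBody d i).denote s 9 0 = s 9 0 + posTerm n m T g R b x i j ∧
    (scoreBody d i).denote s 10 0 = s 10 0 + negTerm n m T g R b x i j ∧
    (scoreBody d i).denote s 11 0 = s 11 0 + totTerm n m T g b x j := by
  classical
  have e1 : ∀ a k, (Expr.var a).eval (s.set a 0 k) = k := by
    intro a k; simp [Expr.eval, Mem.set_apply]
  have hv : ∀ a, (Expr.var a).eval s = s a 0 := fun _ => rfl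
  have hm1 : (PooledData.matE PooledData.headE (.var 7)).eval s = if g (j % T) x then 1 else 0 := by
    rw [h.matE _ _ (by rw [hv, h7]; exact hx), h.headE, hv, h7, h8]
  have hm2 : (PooledData.matE (.var 8) (.var 7)).eval s = if g j x then 1 else 0 := by
    rw [h.matE _ _ (by rw [hv, h7]; exact hx), hv, hv, h7, h8]
  have hmod : j % T < m := (Nat.mod_le _ _).trans_lt hj
  have hadd : ∀ (s' : Mem) (a : ℕ) (e : Expr),
      (addTo a e).denote s' = s'.set a 0 (s' a 0 + e.eval s') := fun _ _ _ => rfl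
  have hw : ∀ (s' : Mem) (e : Expr), ScoreState n m d T g R s' → s' 6 0 = b → s' 8 0 = j →
      (weightE e).eval s' = n / (j % T + 1 - b) * e.eval s' := by
    intro s' e h' h6' h8'
    simp only [weightE, Expr.eval, h'.headE, h'.items, h6', h8']
  have hr1 : ∀ (s' : Mem), ScoreState n m d T g R s' → s' 8 0 = j →
      (resE d (.var 8) (.lit i)).eval s' = R j i := by
    intro s' h' h8'
    simp only [resE, Expr.eval, h8']
    exact h'.res j hj i hi
  have hr2 : ∀ (s' : Mem), ScoreState n m d T g R s' → s' 8 0 = j →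
      (resE d PooledData.headE (.lit i)).eval s' = R (j % T) i := by
    intro s' h' h8'
    simp only [resE, Expr.eval, h'.headE, h8']
    exact h'.res _ hmod i hi
  have hset : ∀ (s' : Mem) (a k : ℕ), 9 ≤ a →
      ScoreState n m d T g R s' ∧ s' 6 0 = b ∧ s' 8 0 = j →
      ScoreState n m d T g R (s'.set a 0 k) ∧ s'.set a 0 k 6 0 = b ∧ s'.set a 0 k 8 0 = j := by
    rintro s' a k ha ⟨h1, h2, h3⟩
    refine ⟨h1.congr ?_ ?_ ?_ ?_, ?_, ?_⟩ <;> rw [Mem.set_of_ne _ _ _ (by omega)] <;> assumption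
  have hb1 : (Expr.sub (.add (.var 8) (.lit 1)) (.var 5)).eval s ≠ 0 ↔ T ≤ j := by
    simp only [Expr.eval, h8, h.headers]; omega
  have hb2 : (Expr.sub (.sub (.read 0 (.lit 1)) (.lit 1)) (.var 8)).eval s ≠ 0 ↔ j + 1 < m := by
    simp only [Expr.eval, h8, h.pools]; omega
  have hl : ∀ (s' : Mem) (c : ℕ), (Expr.lit c).eval s' = c := fun _ _ => rfl
  have hmul : ∀ (s' : Mem) (c e : Expr), (Expr.mul c e).eval s' = c.eval s' * e.eval s' :=
    fun _ _ _ => rfl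
  simp only [PooledData.scoreBody, denote, posTerm, negTerm, totTerm, Relevant]
  by_cases c1 : T ≤ j
  swap
  · rw [if_neg (by rw [hb1]; exact c1)]; simp [c1]
  rw [if_pos (hb1.2 c1)]
  by_cases c2 : j + 1 < m
  swap
  · rw [if_neg (by rw [hb2]; exact c2)]; simp [c2]
  rw [if_pos (hb2.2 c2), hm1]
  by_cases c3 : g (j % T) x
  swap
  · simp [c3]
  have hs : ScoreState n m d T g R s ∧ s 6 0 = b ∧ s 8 0 = j := ⟨h, h6, h8⟩
  rw [hm2]
  by_cases c4 : g j x
  · have hs1 := hset s 9 (s 9 0 + n / (j % T + 1 - b) * (2 * R j i)) (by omega) hs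
    have hs2 := hset _ 10 (s 10 0 + n / (j % T + 1 - b) * R (j % T) i) (by omega) hs1
    simp only [c1, c2, c3, c4, if_true, ne_eq, one_ne_zero, not_false_eq_true, and_self, hadd]
    rw [hw s _ h h6 h8, hmul, hl, hr1 s h h8]
    rw [hw _ _ hs1.1 hs1.2.1 hs1.2.2, hr2 _ hs1.1 hs1.2.2]
    rw [Mem.set_of_ne s (a := 9) (a' := 10) _ _ (by decide)]
    rw [hw _ _ hs2.1 hs2.2.1 hs2.2.2, hl]
    simp [Mem.set_apply]
  · have hs1 := hset s 9 (s 9 0 + n / (j % T + 1 - b) * R (j % T) i) (by omega) hs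
    have hs2 := hset _ 10 (s 10 0 + n / (j % T + 1 - b) * (2 * R j i)) (by omega) hs1
    simp only [c1, c2, c3, c4, if_true, if_false, ne_eq, one_ne_zero, not_false_eq_true, and_self,
      hadd, not_true_eq_false]
    rw [hw s _ h h6 h8, hr2 s h h8]
    rw [hw _ _ hs1.1 hs1.2.1 hs1.2.2, hmul, hl, hr1 _ hs1.1 hs1.2.2]
    rw [Mem.set_of_ne s (a := 9) (a' := 10) _ _ (by decide)]
    rw [hw _ _ hs2.1 hs2.2.1 hs2.2.2, hl]
    simp [Mem.set_apply]

theorem ScoreState.labelTest {g : ℕ → ℕ → Prop} {R : ℕ → ℕ → ℕ} {s : Mem} {b x i : ℕ}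
    (h : ScoreState n m d T g R s) (h6 : s 6 0 = b) (h7 : s 7 0 = x) (hx : x < n) (hi : i ≤ d)
    [Decidable (Accepts n m T p q g R b x i)] (x' : ℕ) :
    (labelTest d p q i).denote s 3 x' =
      if x' = x ∧ Accepts n m T p q g R b x i then i else s 3 x' := by
  rw [PooledData.labelTest, denote_seq, denote_seq]
  set s1 := ForProg.denote _ s with hs1'
  have hs1 : s1 = ((s.set 9 0 0).set 10 0 0).set 11 0 0 := rfl
  have hne : ∀ a, a < 8 → s1 a = s a := by
    intro a ha
    rw [hs1, Mem.set_of_ne _ _ _ (by omega), Mem.set_of_ne _ _ _ (by omega),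
      Mem.set_of_ne _ _ _ (by omega)]
  have hm : s1 0 1 = m := by rw [hne 0 (by omega), h.pools]
  have hl := loop_induction (i := 1) (v := 8) (p := PooledData.scoreBody d i) (s := s1)
    (fun h => by have := scoreBody_writes h; omega)
    (fun k s' => (∀ a, a < 8 → s' a = s a) ∧
      s' 9 0 = ∑ j ∈ range k, posTerm n m T g R b x i j ∧
      s' 10 0 = ∑ j ∈ range k, negTerm n m T g R b x i j ∧
      s' 11 0 = ∑ j ∈ range k, totTerm n m T g b x j)
    ⟨fun a ha => by rw [Mem.set_of_ne _ _ _ (by omega), hne a ha], by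
      simp [hs1, Mem.set_apply]⟩ (by
      rintro k hk s' ⟨hf, e9, e10, e11⟩ h8
      have hS := (h.congr (hf 0 (by omega)) (hf 1 (by omega)) (hf 2 (by omega))
        (hf 5 (by omega))).scoreBody (b := b) (x := x) (i := i)
        (by rw [hf 6 (by omega), h6]) (by rw [hf 7 (by omega), h7]) hx hi h8 (by omega)
      refine ⟨fun a ha => ?_, ?_⟩
      · rw [Mem.set_of_ne _ _ _ (by omega), denote_of_not_writes
          (fun h => by have := scoreBody_writes h; omega), hf a ha]
      · rw [Mem.set_of_ne _ _ _ (by omega), Mem.set_of_ne _ _ _ (by omega),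
          Mem.set_of_ne _ _ _ (by omega), hS.1, hS.2.1, hS.2.2, e9, e10, e11,
          sum_range_succ, sum_range_succ, sum_range_succ]
        exact ⟨rfl, rfl, rfl⟩)
  rw [hm] at hl
  generalize (ForProg.loop 1 8 (PooledData.scoreBody d i)).denote s1 = s2 at hl
  obtain ⟨hf, e9, e10, e11⟩ := hl
  have heval : (Expr.sub (.mul (.lit q) (.var 9))
      (.add (.mul (.lit q) (.var 10)) (.mul (.lit p) (.var 11)))).eval s2 =
      q * ∑ j ∈ range m, posTerm n m T g R b x i j -
      (q * ∑ j ∈ range m, negTerm n m T g R b x i j +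
        p * ∑ j ∈ range m, totTerm n m T g b x j) := by
    simp only [Expr.eval, e9, e10, e11]
  have h7' : (Expr.var 7).eval s2 = x := by simp only [Expr.eval]; rw [hf 7 (by omega), h7]
  by_cases hA : Accepts n m T p q g R b x i
  · rw [denote_ite_of_ne (by rw [heval]; unfold Accepts at hA; omega), denote_assign, h7',
      Mem.set_apply]
    simp only [hA, and_true, true_and]
    rw [hf 3 (by omega)]
    rfl
  · rw [denote_ite_of_eq (by rw [heval]; unfold Accepts at hA; omega)]
    simp only [hA, and_false, if_false, denote]
    rw [hf 3 (by omega)]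

/-- At most one test succeeds, so no later test overwrites a correct output. Label 0 is never
tested: it is the value already in memory. -/
theorem ScoreState.labelTests {g : ℕ → ℕ → Prop} {R : ℕ → ℕ → ℕ} {s : Mem} {b x l : ℕ}
    (h : ScoreState n m d T g R s) (h6 : s 6 0 = b) (h7 : s 7 0 = x) (hx : x < n)
    (h3 : s 3 x = 0) (hl : ∀ i, 1 ≤ i → i ≤ d → (Accepts n m T p q g R b x i ↔ l = i))
    {i : ℕ} (hi : i ≤ d) (x' : ℕ) :
    (labelTests d p q i).denote s 3 x' = if x' = x then (if l ≤ i then l else 0) else s 3 x' := by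
  classical
  induction i generalizing x' with
  | zero =>
    simp only [PooledData.labelTests, denote]
    split_ifs with h1 h2
    · rw [h1, h3]; omega
    · rw [h1, h3]
    · rfl
  | succ i ih =>
    have hf : ∀ a, a ≠ 3 → a < 8 → (PooledData.labelTests d p q i).denote s a = s a := fun a h1 h2 =>
      denote_of_not_writes (fun h => by have := labelTests_writes h; omega) s
    have hS := h.congr (hf 0 (by omega) (by omega)) (hf 1 (by omega) (by omega))
      (hf 2 (by omega) (by omega)) (hf 5 (by omega) (by omega))
    simp only [PooledData.labelTests, denote]
    rw [hS.labelTest (by rw [hf 6 (by omega) (by omega), h6])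
      (by rw [hf 7 (by omega) (by omega), h7]) hx hi, ih (by omega), hl (i + 1) (by omega) hi]
    split_ifs <;> omega

variable {g : ℕ → ℕ → Prop} {lab : ℕ → ℕ}

open Classical in
/-- The memory when exactly the items in `D` have been decoded, all of them correctly. -/
structure DecodedState (n m d T : ℕ) (g : ℕ → ℕ → Prop) (lab : ℕ → ℕ) (D : ℕ → Prop) (s : Mem) :
    Prop extends ScoreState n m d T g (residual n g lab D) s where
  done : ∀ x < n, s 4 x = if D x then 1 else 0
  out : ∀ x < n, s 3 x = if D x then lab x else 0

theorem residual_congr {D D' : ℕ → Prop} (h : ∀ x < n, D x ↔ D' x) :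
    residual n g lab D = residual n g lab D' := by
  funext j ω
  unfold residual
  congr 1
  ext y
  simp only [mem_filter, mem_range]
  constructor <;> rintro ⟨h1, h2⟩
  · exact ⟨h1, by rwa [← h y h1]⟩
  · exact ⟨h1, by rwa [h y h1]⟩

theorem residual_insert {D D' : ℕ → Prop} {x : ℕ} (hx : x < n) (hxD : ¬ D x)
    (h : ∀ y < n, D' y ↔ D y ∨ y = x) (j ω : ℕ) [Decidable (g j x ∧ lab x = ω)] :
    residual n g lab D' j ω = residual n g lab D j ω - if g j x ∧ lab x = ω then 1 else 0 := by
  classical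
  unfold residual
  split_ifs with hc
  · rw [← card_erase_of_mem (a := x)]
    · congr 1
      ext y
      simp only [mem_filter, mem_range, mem_erase]
      constructor
      · rintro ⟨h1, h2, h3, h4⟩
        rw [h y h1, not_or] at h3
        exact ⟨h3.2, h1, h2, h3.1, h4⟩
      · rintro ⟨h1, h2, h3, h4, h5⟩
        exact ⟨h2, h3, by rw [h y h2]; tauto, h5⟩
    · simp only [mem_filter, mem_range]
      exact ⟨hx, hc.1, hxD, hc.2⟩
  · rw [Nat.sub_zero]
    congr 1
    ext y
    simp only [mem_filter, mem_range]
    constructor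
    · rintro ⟨h1, h2, h3, h4⟩
      rw [h y h1, not_or] at h3
      exact ⟨h1, h2, h3.1, h4⟩
    · rintro ⟨h1, h2, h3, h4⟩
      refine ⟨h1, h2, ?_, h4⟩
      rw [h y h1]
      rintro (h5 | rfl)
      · exact h3 h5
      · exact hc ⟨h2, h4⟩

theorem DecodedState.congr {D D' : ℕ → Prop} {s s' : Mem}
    (h : DecodedState n m d T g lab D s) (hD : ∀ x < n, D x ↔ D' x)
    (hs : ∀ a < 6, s' a = s a) : DecodedState n m d T g lab D' s' := by
  classical
  refine ⟨?_, fun x hx => ?_, fun x hx => ?_⟩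
  · rw [← residual_congr hD]
    exact h.toScoreState.congr (hs 0 (by omega)) (hs 1 (by omega)) (hs 2 (by omega))
      (hs 5 (by omega))
  · rw [hs 4 (by omega), h.done x hx]
    simp only [hD x hx]
  · rw [hs 3 (by omega), h.out x hx]
    simp only [hD x hx]

theorem DecodedState.decodeItem {D D' : ℕ → Prop} {s : Mem} {b x : ℕ}
    (h : DecodedState n m d T g lab D s) (h6 : s 6 0 = b) (h7 : s 7 0 = x) (hx : x < n)
    (hxD : ¬ D x) (hD' : ∀ y < n, D' y ↔ D y ∨ y = x) (hlab : lab x ≤ d)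
    (hl : ∀ i, 1 ≤ i → i ≤ d →
      (Accepts n m T p q g (residual n g lab D) b x i ↔ lab x = i)) :
    DecodedState n m d T g lab D' ((decodeItem d p q).denote s) := by
  classical
  rw [PooledData.decodeItem, denote_seq, denote_seq, denote_assign]
  have hf : ∀ a, a ≠ 3 → a < 8 → (labelTests d p q d).denote s a = s a := fun a h1 h2 =>
    denote_of_not_writes (fun h => by have := labelTests_writes h; omega) s
  have h3 := fun x' => h.toScoreState.labelTests h6 h7 hx (by rw [h.out x hx, if_neg hxD]) hl
    le_rfl x'
  simp only [if_pos hlab] at h3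
  generalize (labelTests d p q d).denote s = s1 at hf h3
  have e7 : (Expr.var 7).eval s1 = x := by
    simp only [Expr.eval]; rw [hf 7 (by omega) (by omega), h7]
  rw [e7, show (Expr.lit 1).eval s1 = 1 from rfl]
  set s2 := s1.set 4 x 1 with hs2
  have hf2 : ∀ a, a ≠ 3 → a ≠ 4 → a < 8 → s2 a = s a := fun a h1 h2 h3 => by
    rw [hs2, Mem.set_of_ne _ _ _ h2, hf a h1 h3]
  have h23 : ∀ x', s2 3 x' = if x' = x then lab x else s 3 x' := fun x' => by
    rw [hs2, Mem.set_of_ne _ _ _ (by decide), h3]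
  have h24 : ∀ x', s2 4 x' = if x' = x then 1 else s 4 x' := fun x' => by
    rw [hs2, Mem.set_apply, hf 4 (by omega) (by omega)]
    simp
  have hw : ∀ a, (removeBody d).Writes a → a = 2 := by
    intro a h
    simpa only [removeBody, Writes, or_false] using h
  have hm : s2 0 1 = m := by rw [hf2 0 (by omega) (by omega) (by omega), h.pools]
  have hloop := loop_induction (i := 1) (v := 8) (p := removeBody d) (s := s2)
    (fun h => by have := hw 8 h; omega)
    -- Midway, the item has been removed from the rows below `k` and from no others.
    (fun k s' => (∀ a, a ≠ 2 → a < 8 → s' a = s2 a) ∧ ∀ j < m, ∀ ω ≤ d,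
      s' 2 ((d + 1) * j + ω) = residual n g lab (if j < k then D' else D) j ω)
    ⟨fun a _ ha => by rw [Mem.set_of_ne _ _ _ (by omega)], fun j hj ω hω => by
      rw [Mem.set_of_ne _ _ _ (by decide), hf2 2 (by decide) (by decide) (by decide),
        h.res j hj ω hω]
      simp⟩ (by
      rintro k hk s' ⟨hs', hr⟩ h8
      rw [hm] at hk
      refine ⟨fun a ha ha' => ?_, fun j hj ω hω => ?_⟩
      · rw [Mem.set_of_ne _ _ _ (by omega), denote_of_not_writes (fun h => ha (hw a h)),
          hs' a ha ha']
      rw [Mem.set_of_ne _ _ _ (by decide)]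
      have hrk := hr k hk
      simp only [lt_irrefl, if_false] at hrk
      have ex : (Expr.var 7).eval s' = x := by
        simp only [Expr.eval]
        rw [hs' 7 (by omega) (by omega), hf2 7 (by omega) (by omega) (by omega), h7]
      have ek : (Expr.var 8).eval s' = k := h8
      have em : (matE (.var 8) (.var 7)).eval s' = if g k x then 1 else 0 := by
        have e0 : s' 0 0 = n := by
          rw [hs' 0 (by omega) (by omega), hf2 0 (by omega) (by omega) (by omega), h.items]
        have e1 : s' 1 = s 1 := by
          rw [hs' 1 (by omega) (by omega), hf2 1 (by omega) (by omega) (by omega)]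
        simp only [matE, Expr.eval] at *
        rw [e0, e1, ek, ex, Nat.div_one, h.matrix _ _ hx]
      have eo : (Expr.read 3 (.var 7)).eval s' = lab x := by
        rw [Expr.eval, ex, hs' 3 (by omega) (by omega), h23, if_pos rfl]
      have ei : (Expr.add (.mul (.lit (d + 1)) (.var 8)) (.read 3 (.var 7))).eval s' =
          (d + 1) * k + lab x := by
        rw [Expr.eval, eo, Expr.eval, ek, Expr.eval]
      -- Different pairs of pool and label occupy different cells because labels are below `d + 1`.
      have hidx : (d + 1) * j + ω = (d + 1) * k + lab x ↔ j = k ∧ ω = lab x := by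
        refine ⟨fun h => ?_, fun ⟨h1, h2⟩ => by rw [h1, h2]⟩
        have h1 := congrArg (· / (d + 1)) h
        simp only [Nat.mul_add_div (Nat.succ_pos d),
          Nat.div_eq_of_lt (show ω < d + 1 by omega),
          Nat.div_eq_of_lt (show lab x < d + 1 by omega)] at h1
        have h1 : j = k := by omega
        subst h1
        exact ⟨rfl, by omega⟩
      have hres := residual_insert (lab := lab) (g := g) hx hxD hD' k ω
      rw [removeBody]
      by_cases hg : g k x
      · rw [denote_ite_of_ne (by rw [em]; simp [hg]), denote_assign, ei, Mem.set_apply]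
        simp only [true_and, hidx]
        by_cases hjk : j = k
        · subst hjk
          simp only [true_and, Nat.lt_succ_self, if_true]
          rw [hres]
          by_cases hωx : ω = lab x
          · subst hωx
            simp only [hg, and_self, if_true, Expr.eval, resE] at eo ⊢
            rw [eo]
            simp only [Expr.eval] at ek
            rw [ek, hrk _ hω]
          · rw [if_neg hωx, if_neg (fun h => hωx h.2.symm), hrk _ hω, Nat.sub_zero]
        · rw [if_neg (fun h => hjk h.1), hr j hj ω hω]
          simp only [show j < k + 1 ↔ j < k by omega]
      · rw [denote_ite_of_eq (by rw [em]; simp [hg]), ForProg.denote, hr j hj ω hω]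
        by_cases hjk : j = k
        · subst hjk
          simp only [lt_irrefl, if_false, Nat.lt_succ_self, if_true]
          rw [hres]
          simp [hg]
        · simp only [show j < k + 1 ↔ j < k by omega])
  rw [hm] at hloop
  obtain ⟨hs', hr⟩ := hloop
  have hfin : ∀ a, a ≠ 2 → a ≠ 3 → a ≠ 4 → a < 8 →
      (ForProg.loop 1 8 (removeBody d)).denote s2 a = s a := fun a h1 h2 h3 h4 => by
    rw [hs' a h1 h4, hf2 a h2 h3 h4]
  refine ⟨⟨?_, ?_, ?_, ?_, fun j hj ω hω => ?_⟩, fun y hy => ?_, fun y hy => ?_⟩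
  · rw [hfin 0 (by omega) (by omega) (by omega) (by omega), h.items]
  · rw [hfin 0 (by omega) (by omega) (by omega) (by omega), h.pools]
  · rw [hfin 1 (by omega) (by omega) (by omega) (by omega)]; exact h.matrix
  · rw [hfin 5 (by omega) (by omega) (by omega) (by omega), h.headers]
  · rw [hr j hj ω hω, if_pos hj]
  · rw [hs' 4 (by omega) (by omega), h24, h.done y hy]
    simp only [hD' y hy]
    by_cases hyx : y = x <;> simp [hyx]
  · rw [hs' 3 (by omega) (by omega), h23, h.out y hy]
    simp only [hD' y hy]
    by_cases hyx : y = x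
    · simp [hyx]
    · simp [hyx]

theorem DecodedState.visitItem {s : Mem} {b x : ℕ}
    (h : DecodedState n m d T g lab (Decoded g b x) s) (h6 : s 6 0 = b) (h7 : s 7 0 = x)
    (hx : x < n) (hlab : lab x ≤ d)
    (hl : g b x → (∀ b' < b, ¬ g b' x) → ∀ i, 1 ≤ i → i ≤ d →
      (Accepts n m T p q g (residual n g lab (Decoded g b x)) b x i ↔ lab x = i)) :
    DecodedState n m d T g lab (Decoded g b (x + 1)) ((visitItem d p q).denote s) := by
  classical
  have ex : (Expr.var 7).eval s = x := h7
  have eb : (Expr.var 6).eval s = b := h6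
  -- Truncated subtraction of two bits is "in the pool and not yet decoded".
  have e1 : (Expr.sub (matE (.var 6) (.var 7)) (.read 4 (.var 7))).eval s =
      (if g b x then 1 else 0) - if Decoded g b x x then 1 else 0 := by
    rw [Expr.eval, h.toScoreState.matE _ _ (by rw [ex]; exact hx), eb, ex,
      show (Expr.read 4 (.var 7)).eval s = s 4 ((Expr.var 7).eval s) from rfl, ex, h.done x hx]
  have hDx : Decoded g b x x ↔ ∃ b' < b, g b' x := by simp [Decoded]
  have hstep : ∀ y, Decoded g b (x + 1) y ↔ Decoded g b x y ∨ (y = x ∧ g b x) := by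
    intro y
    unfold Decoded
    constructor
    · rintro (h | ⟨h1, h2⟩)
      · exact Or.inl (Or.inl h)
      · rcases Nat.lt_succ_iff_lt_or_eq.1 h2 with h2 | rfl
        · exact Or.inl (Or.inr ⟨h1, h2⟩)
        · exact Or.inr ⟨rfl, h1⟩
    · rintro ((h | ⟨h1, h2⟩) | ⟨rfl, h⟩)
      · exact Or.inl h
      · exact Or.inr ⟨h1, by omega⟩
      · exact Or.inr ⟨h, by omega⟩
  rw [PooledData.visitItem]
  by_cases hg : g b x
  · by_cases hD : Decoded g b x x
    · rw [denote_ite_of_eq (by rw [e1, if_pos hg, if_pos hD])]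
      refine h.congr (fun y _ => ?_) (fun _ _ => rfl)
      rw [hstep]
      refine ⟨Or.inl, ?_⟩
      rintro (h | ⟨rfl, -⟩)
      · exact h
      · exact hD
    · rw [denote_ite_of_ne (by rw [e1, if_pos hg, if_neg hD]; decide)]
      refine h.decodeItem h6 h7 hx hD (fun y _ => ?_) hlab (hl hg fun b' hb' h' => ?_)
      · rw [hstep]; simp [hg]
      · exact hD (hDx.2 ⟨b', hb', h'⟩)
  · rw [denote_ite_of_eq (by rw [e1]; simp [hg])]
    refine h.congr (fun y _ => ?_) (fun _ _ => rfl)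
    rw [hstep]; simp [hg]

theorem DecodedState.phases {s : Mem} (h : DecodedState n m d T g lab (fun _ => False) s)
    (hlab : ∀ x < n, lab x ≤ d)
    (hl : ∀ b < m, ∀ x < n, g b x → (∀ b' < b, ¬ g b' x) → ∀ i, 1 ≤ i → i ≤ d →
      (Accepts n m T p q g (residual n g lab (Decoded g b x)) b x i ↔ lab x = i)) :
    DecodedState n m d T g lab (Decoded g m 0)
      ((ForProg.loop 1 6 (.loop 0 7 (PooledData.visitItem d p q))).denote s) := by
  have hw : ∀ a, 5 ≤ a → a ≤ 7 → ¬ (PooledData.visitItem d p q).Writes a := fun a h1 h2 h => by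
    have := visitItem_writes h; omega
  have houter := loop_induction (i := 1) (v := 6) (p := .loop 0 7 (PooledData.visitItem d p q)) (s := s)
    (fun h => h.elim (fun h => absurd h (by decide)) (hw 6 (by omega) (by omega)))
    (fun b s' => DecodedState n m d T g lab (Decoded g b 0) s')
    (h.congr (fun x _ => by simp [Decoded]) fun a ha => Mem.set_of_ne _ _ _ (by omega)) (by
      intro b hb s1 hs1 h16
      rw [h.pools] at hb
      have hinner := loop_induction (i := 0) (v := 7) (p := PooledData.visitItem d p q) (s := s1)
        (hw 7 (by omega) (by omega))
        (fun x s' => s' 6 0 = b ∧ DecodedState n m d T g lab (Decoded g b x) s')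
        ⟨by rw [Mem.set_of_ne _ _ _ (by decide), h16],
          hs1.congr (fun x _ => Iff.rfl) fun a ha => Mem.set_of_ne _ _ _ (by omega)⟩ (by
          rintro x hx s2 ⟨h26, hs2⟩ h27
          rw [hs1.items] at hx
          refine ⟨?_, (hs2.visitItem h26 h27 hx (hlab x hx) (hl b hb x hx)).congr
            (fun _ _ => Iff.rfl) fun a ha => Mem.set_of_ne _ _ _ (by omega)⟩
          rw [Mem.set_of_ne _ _ _ (by decide), denote_of_not_writes (hw 6 (by omega) (by omega)),
            h26])
      rw [hs1.items] at hinner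
      refine hinner.2.congr (fun x hx => ?_) fun a ha => Mem.set_of_ne _ _ _ (by omega)
      -- The end of phase `b` is the beginning of phase `b + 1`, as all items are below `n`.
      simp only [Decoded, not_lt_zero, and_false, or_false, hx, and_true]
      constructor
      · rintro (⟨b', h1, h2⟩ | h1)
        · exact ⟨b', by omega, h2⟩
        · exact ⟨b, by omega, h1⟩
      · rintro ⟨b', h1, h2⟩
        rcases Nat.lt_succ_iff_lt_or_eq.1 h1 with h1 | rfl
        · exact Or.inl ⟨b', h1, h2⟩
        · exact Or.inr h2)
  rwa [h.pools] at houter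

theorem denote_clampOutput (d : ℕ) (s : Mem) {x : ℕ} (hx : x < s 0 0) :
    (clampOutput d).denote s 3 x = min (s 3 x) d := by
  have hloop := loop_induction (i := 0) (v := 7)
    (p := .assign 3 (.var 7) (.sub (.read 3 (.var 7)) (.sub (.read 3 (.var 7)) (.lit d)))) (s := s)
    (fun h => absurd h (by simp [Writes]))
    (fun k s' => ∀ y, s' 3 y = if y < k then min (s 3 y) d else s 3 y)
    (fun y => by rw [Mem.set_of_ne _ _ _ (by decide)]; simp) (by
      intro k _ s' hs' h7 y
      rw [Mem.set_of_ne _ _ _ (by decide), denote_assign, Mem.set_apply]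
      simp only [Expr.eval, h7, true_and]
      rw [hs' k, hs' y]
      by_cases hy : y = k
      · subst hy
        simp only [if_true, lt_irrefl, if_false, Nat.lt_succ_self]
        omega
      · rw [if_neg hy]
        simp only [show y < k + 1 ↔ y < k by omega])
  have := hloop x
  rwa [if_pos hx] at this

theorem denote_countHeaders {s : Mem} (h0 : s 0 0 = n) (h1 : s 0 1 = m)
    [∀ j x, Decidable (g j x)] (hm : ∀ j x, x < n → s 1 (n * j + x) = if g j x then 1 else 0)
    (h5 : s 5 0 = 0) : countHeaders.denote s 5 0 = #{x ∈ range n | g (m - 1) x} := by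
  have hloop := loop_induction (i := 0) (v := 7)
    (p := addTo 5 (matE (.sub (.read 0 (.lit 1)) (.lit 1)) (.var 7))) (s := s)
    (fun h => absurd h (by simp [addTo_writes]))
    (fun k s' => (∀ a < 2, s' a = s a) ∧ s' 5 0 = #{x ∈ range k | g (m - 1) x})
    ⟨fun a ha => Mem.set_of_ne _ _ _ (by omega), by
      rw [Mem.set_of_ne _ _ _ (by decide), h5]; simp⟩ (by
      rintro k hk s' ⟨hf, hs'⟩ h7
      rw [h0] at hk
      refine ⟨fun a ha => ?_, ?_⟩
      · rw [Mem.set_of_ne _ _ _ (by omega), denote_of_not_writes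
          (fun h => by rw [addTo_writes] at h; omega), hf a ha]
      · rw [Mem.set_of_ne _ _ _ (by decide), addTo, denote_assign, Mem.set_apply]
        simp only [Expr.eval, matE, h7, hf 0 (by omega), hf 1 (by omega), h0, h1, Nat.div_one, hs',
          hm _ _ hk, and_self, if_true]
        rw [range_add_one, filter_insert]
        split_ifs with h
        · rw [card_insert_of_notMem (by simp)]
        · rfl)
  rw [h0] at hloop
  exact hloop.2

end Correctness

/-! ### From the program to a decoder on pooling schemes. -/

section Decode

open ForProg

/-- The incidence relation of a pooling scheme, on natural numbers. -/
def incidence {n m : ℕ} (G : PoolingScheme n m) (j x : ℕ) : Prop :=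
  ∃ (hj : j < m) (hx : x < n), (⟨x, hx⟩ : Fin n) ∈ G ⟨j, hj⟩

/-- A label vector, on natural numbers. -/
def labelOf {n d : ℕ} (σ : Fin n → Fin (d + 1)) (x : ℕ) : ℕ :=
  if h : x < n then (σ ⟨x, h⟩ : ℕ) else 0

/-- The decoder computed by `decoderProg`. -/
noncomputable def thresholdDecoder (d p q : ℕ) : Decoder d := fun _ _ G y x =>
  ⟨min ((decoderProg d p q).denote (encode G y) 3 x) d, Nat.lt_succ_of_le (min_le_right _ _)⟩

variable {n m d : ℕ} (G : PoolingScheme n m) (σ : Fin n → Fin (d + 1))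

open Classical in
theorem encode_matrix (y : Fin m → Fin (d + 1) → ℕ) {j x : ℕ} (hx : x < n) :
    encode G y 1 (n * j + x) = if incidence G j x then 1 else 0 := by
  simp only [encode]
  congr 1
  refine propext ⟨?_, ?_⟩
  · rintro ⟨j', x', hmem, hidx⟩
    have hn : 0 < n := by omega
    have h1 := congrArg (· / n) hidx
    simp only [Nat.mul_add_div hn, mul_comm (j' : ℕ) n, Nat.div_eq_of_lt hx,
      Nat.div_eq_of_lt x'.2, add_zero] at h1
    subst h1
    have h2 : x = x' := by rw [mul_comm] at hidx; omega
    subst h2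
    exact ⟨j'.2, x'.2, hmem⟩
  · rintro ⟨hj, hx', hmem⟩
    exact ⟨⟨j, hj⟩, ⟨x, hx'⟩, hmem, by rw [mul_comm]⟩

theorem encode_measurement {j ω : ℕ} (hj : j < m) (hω : ω ≤ d) :
    encode G (measurement G σ) 2 ((d + 1) * j + ω) =
      residual n (incidence G) (labelOf σ) (fun _ => False) j ω := by
  have h1 : ((d + 1) * j + ω) / (d + 1) = j := by
    rw [Nat.mul_add_div (Nat.succ_pos d), Nat.div_eq_of_lt (by omega), add_zero]
  have h2 : ((d + 1) * j + ω) % (d + 1) = ω := by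
    rw [Nat.mul_add_mod, Nat.mod_eq_of_lt (by omega)]
  classical
  simp only [encode, h1, h2, hj, dif_pos, measurement, residual]
  symm
  refine card_bij' (fun y hy => ⟨y, mem_range.1 (mem_filter.1 hy).1⟩) (fun x _ => (x : ℕ)) ?_ ?_
    (fun _ _ => rfl) (fun _ _ => rfl)
  · intro y hy
    simp only [mem_filter, mem_range] at hy ⊢
    obtain ⟨hy, ⟨_, _, hmem⟩, -, hlab⟩ := hy
    rw [labelOf, dif_pos hy] at hlab
    exact ⟨hmem, Fin.ext hlab⟩
  · intro x hx
    simp only [mem_filter, mem_range] at hx ⊢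
    exact ⟨x.2, ⟨hj, x.2, hx.1⟩, not_false, by rw [labelOf, dif_pos x.2, hx.2]⟩

theorem polyTime_thresholdDecoder (d p q : ℕ) : PolyTime (thresholdDecoder d p q) := by
  obtain ⟨c, hc⟩ := exists_polyTime (decoderProg_wellFormed d p q)
  refine ⟨(decoderProg d p q).compile, c, fun n m G σ => ?_⟩
  obtain ⟨t, ht, ht'⟩ := hc (n + m) (encode G (measurement G σ)) (by simp [encode])
    (by simp [encode]) (by
      intro a i
      unfold encode
      split
      · omega
      · omega
      · split_ifs <;> omega
      · split_ifs
        · refine (card_le_univ _).trans ?_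
          rw [Fintype.card_fin]; omega
        · omega
      · omega)
  refine ⟨_, t, ht, ht', fun x => ?_⟩
  simp only [thresholdDecoder, decoderProg, denote_seq]
  -- The decoder truncates at `d` to land in `Fin (d + 1)`. The program clamps as well, so the two
  -- agree even on inputs where decoding fails.
  rw [denote_clampOutput, min_assoc, min_self]
  have hz : ∀ s : Mem, (seq countHeaders (ForProg.loop 1 6 (.loop 0 7 (visitItem d p q)))).denote s 0
      = s 0 := denote_of_not_writes (WellFormed.not_writes_zero (decoderProg_wellFormed d p q).1)
  rw [← denote_seq, hz]
  exact x.2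

/-- `hacc` speaks of the residuals under the true labels, not of what the decoder has output so far.
It is thus a condition on the scheme and the labels alone, ready for a union bound; the induction in
`DecodedState.phases` turns it into correctness of the run. -/
theorem thresholdDecoder_eq {p q T : ℕ}
    (hT : ∀ [∀ x, Decidable (incidence G (m - 1) x)], #{x ∈ range n | incidence G (m - 1) x} = T)
    (hcover : ∀ x < n, ∃ b < m, incidence G b x)
    (hacc : ∀ b < m, ∀ x < n, incidence G b x → (∀ b' < b, ¬ incidence G b' x) →
      ∀ i, 1 ≤ i → i ≤ d → (Accepts n m T p q (incidence G)
        (residual n (incidence G) (labelOf σ) (Decoded (incidence G) b x)) b x i ↔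
          labelOf σ x = i)) :
    thresholdDecoder d p q n m G (measurement G σ) = σ := by
  classical
  have hlab : ∀ x < n, labelOf σ x ≤ d := fun x hx => by
    rw [labelOf, dif_pos hx]; have := (σ ⟨x, hx⟩).2; omega
  set s := encode G (measurement G σ) with hs
  have hw : ∀ a, a ≠ 5 → a ≠ 7 → countHeaders.denote s a = s a := fun a h1 h2 =>
    denote_of_not_writes (by simp [countHeaders, Writes, addTo_writes, h1, h2]) s
  have hinit : DecodedState n m d T (incidence G) (labelOf σ) (fun _ => False)
      (countHeaders.denote s) := by
    refine ⟨⟨?_, ?_, ?_, ?_, ?_⟩, ?_, ?_⟩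
    · rw [hw 0 (by decide) (by decide)]; rfl
    · rw [hw 0 (by decide) (by decide)]; rfl
    · rw [hw 1 (by decide) (by decide)]
      exact fun j x hx => encode_matrix G _ hx
    · rw [denote_countHeaders (n := n) (m := m) (g := incidence G) rfl rfl
        (fun j x hx => encode_matrix G _ hx) rfl]
      exact hT
    · rw [hw 2 (by decide) (by decide)]
      exact fun j hj ω hω => encode_measurement G σ hj hω
    · intro x _; rw [hw 4 (by decide) (by decide)]; simp [hs, encode]
    · intro x _; rw [hw 3 (by decide) (by decide)]; simp [hs, encode]
  have hfin := hinit.phases (p := p) (q := q) hlab hacc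
  funext x
  apply Fin.ext
  simp only [thresholdDecoder, decoderProg, denote_seq, ← hs]
  rw [denote_clampOutput _ _ (by rw [hfin.items]; exact x.2), hfin.out x x.2, if_pos]
  · have := (σ x).2
    rw [labelOf, dif_pos x.2]
    simp only [Fin.eta]
    omega
  · obtain ⟨b, hb, h⟩ := hcover x x.2
    exact Or.inl ⟨b, hb, h⟩

end Decode

/-! ### Hoeffding and Chernoff bounds by counting. -/

section Concentration

/-- The sign of a Boolean. -/
def boolSign (b : Bool) : ℝ := if b then 1 else -1

/-- Independence factorises the exponential moment, and `cosh x ≤ exp (x ^ 2 / 2)` bounds each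
factor. -/
theorem sum_exp_mul_boolSign {ι : Type*} [Fintype ι] [DecidableEq ι] (c : ι → ℝ) :
    ∑ ε : ι → Bool, Real.exp (∑ i, c i * boolSign (ε i)) ≤
      Fintype.card (ι → Bool) * Real.exp ((∑ i, c i ^ 2) / 2) := by
  calc ∑ ε : ι → Bool, Real.exp (∑ i, c i * boolSign (ε i))
      = ∑ ε : ι → Bool, ∏ i, Real.exp (c i * boolSign (ε i)) := by simp_rw [Real.exp_sum]
    _ = ∏ i, ∑ b : Bool, Real.exp (c i * boolSign b) := by
        rw [Finset.prod_univ_sum, Fintype.piFinset_univ]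
    _ ≤ ∏ i, (2 * Real.exp (c i ^ 2 / 2)) := by
        refine prod_le_prod (fun i _ => sum_nonneg fun b _ => (Real.exp_pos _).le) fun i _ => ?_
        have := Real.cosh_le_exp_half_sq (c i)
        rw [Real.cosh_eq] at this
        simp only [Fintype.sum_bool, boolSign, if_true, Bool.false_eq_true, if_false, mul_one,
          mul_neg]
        linarith
    _ = _ := by
        rw [prod_mul_distrib, ← Real.exp_sum, sum_div]
        simp

/-- Hoeffding's inequality for Rademacher sums, in counting form. -/
theorem card_le_of_rademacher {ι : Type*} [Fintype ι] [DecidableEq ι] (c : ι → ℝ) {a B : ℝ}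
    (ha : 0 ≤ a) (hB : 0 < B) (hc : ∑ i, c i ^ 2 ≤ B) :
    (#{ε : ι → Bool | a ≤ ∑ i, c i * boolSign (ε i)} : ℝ) ≤
      Fintype.card (ι → Bool) * Real.exp (-(a ^ 2 / (2 * B))) := by
  -- The tilt that minimises `l ^ 2 * B / 2 - l * a`.
  set l := a / B with hl
  have hl0 : 0 ≤ l := by positivity
  have h1 := sum_exp_mul_boolSign (fun i => l * c i)
  have h2 : (#{ε : ι → Bool | a ≤ ∑ i, c i * boolSign (ε i)} : ℝ) * Real.exp (l * a) ≤
      ∑ ε : ι → Bool, Real.exp (∑ i, l * c i * boolSign (ε i)) := by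
    rw [← nsmul_eq_mul, ← sum_const]
    refine (sum_le_sum fun ε hε => ?_).trans
      (sum_le_sum_of_subset_of_nonneg (filter_subset _ _) fun _ _ _ => (Real.exp_pos _).le)
    rw [mem_filter] at hε
    refine Real.exp_le_exp.2 ?_
    simp_rw [mul_assoc]
    rw [← mul_sum]
    exact mul_le_mul_of_nonneg_left hε.2 hl0
  have h3 : (∑ i, (l * c i) ^ 2) / 2 ≤ l ^ 2 * B / 2 := by
    simp_rw [mul_pow]
    rw [← mul_sum]
    gcongr
  have h4 : Real.exp (-(a ^ 2 / (2 * B))) = Real.exp (l ^ 2 * B / 2) / Real.exp (l * a) := by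
    rw [← Real.exp_sub]
    congr 1
    rw [hl]; field_simp; ring
  rw [h4, ← mul_div_assoc, le_div_iff₀ (Real.exp_pos _)]
  exact (h2.trans h1).trans (mul_le_mul_of_nonneg_left (Real.exp_le_exp.2 h3) (by positivity))

/-- The involution that multiplies all signs of a row by the sign in column `x`. -/
def flipRow {J I : Type*} [DecidableEq I] (x : I) (ε : J × I → Bool) : J × I → Bool :=
  fun i => if i.2 = x then ε i else (ε (i.1, x) == ε i)

theorem flipRow_involutive {J I : Type*} [DecidableEq I] (x : I) :
    Function.Involutive (flipRow (J := J) x) := by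
  intro ε
  funext ⟨j, y⟩
  simp only [flipRow, if_true]
  split_ifs
  · rfl
  · cases ε (j, x) <;> cases ε (j, y) <;> rfl

theorem boolSign_beq (a b : Bool) : boolSign (a == b) = boolSign a * boolSign b := by
  cases a <;> cases b <;> simp [boolSign]

/-- Hoeffding's inequality for a Rademacher chaos in which one column is involved. -/
theorem card_le_of_chaos {J I : Type*} [Fintype J] [Fintype I] [DecidableEq J] [DecidableEq I]
    (x : I) (c : J × I → ℝ) (hx : ∀ j, c (j, x) = 0) {a B : ℝ}
    (ha : 0 ≤ a) (hB : 0 < B) (hc : ∑ i, c i ^ 2 ≤ B) :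
    (#{ε : J × I → Bool | a ≤ ∑ i, c i * (boolSign (ε (i.1, x)) * boolSign (ε i))} : ℝ) ≤
      Fintype.card (J × I → Bool) * Real.exp (-(a ^ 2 / (2 * B))) := by
  refine le_trans (Nat.cast_le.2 ?_) (card_le_of_rademacher c ha hB hc)
  -- This bijection of the coins turns each product of two signs into a single sign; the unchanged
  -- column `x` is harmless since `c` vanishes there.
  refine card_le_card_of_injOn (flipRow x) (fun ε hε => ?_) (flipRow_involutive x).injective.injOn
  simp only [coe_filter, mem_univ, true_and, Set.mem_ofPred_eq] at hε ⊢
  refine hε.trans (le_of_eq (sum_congr rfl fun i _ => ?_))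
  by_cases h : i.2 = x
  · have : c i = 0 := by rw [← hx i.1, ← h]
    simp [this]
  · rw [flipRow, if_neg h, boolSign_beq]

/-- Chernoff's inequality for the number of elements of `S` in a block of a random partition. -/
theorem card_le_of_block {I : Type*} [Fintype I] [DecidableEq I] {l : ℕ} (hl : 0 < l)
    (S : Finset I) (b : Fin l) {μ κ t : ℝ} (ht : 0 ≤ t) (hμ : (#S : ℝ) ≤ μ * l) :
    (#{β : I → Fin l | κ < #{y ∈ S | β y = b}} : ℝ) ≤
      Fintype.card (I → Fin l) * Real.exp (μ * (Real.exp t - 1) - t * κ) := by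
  have hl' : (0 : ℝ) < l := Nat.cast_pos.2 hl
  have het : 0 ≤ Real.exp t - 1 := by linarith [Real.one_le_exp ht]
  have h1 : (#{β : I → Fin l | κ < #{y ∈ S | β y = b}} : ℝ) * Real.exp (t * κ) ≤
      ∑ β : I → Fin l, Real.exp (∑ y, if y ∈ S ∧ β y = b then t else 0) := by
    rw [← nsmul_eq_mul, ← sum_const]
    refine (sum_le_sum fun β hβ => ?_).trans
      (sum_le_sum_of_subset_of_nonneg (filter_subset _ _) fun _ _ _ => (Real.exp_pos _).le)
    rw [mem_filter] at hβ
    refine Real.exp_le_exp.2 ?_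
    rw [← sum_filter, sum_const, nsmul_eq_mul, mul_comm]
    refine mul_le_mul_of_nonneg_right (hβ.2.le.trans (le_of_eq ?_)) ht
    congr 2
    ext y
    simp
  have h2 : ∑ β : I → Fin l, Real.exp (∑ y, if y ∈ S ∧ β y = b then t else 0) ≤
      Fintype.card (I → Fin l) * Real.exp (μ * (Real.exp t - 1)) := by
    calc ∑ β : I → Fin l, Real.exp (∑ y, if y ∈ S ∧ β y = b then t else 0)
        = ∑ β : I → Fin l, ∏ y, Real.exp (if y ∈ S ∧ β y = b then t else 0) := by
          simp_rw [Real.exp_sum]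
      _ = ∏ y : I, ∑ c : Fin l, Real.exp (if y ∈ S ∧ c = b then t else 0) := by
          rw [Finset.prod_univ_sum, Fintype.piFinset_univ]
      _ ≤ ∏ y : I, ((l : ℝ) * Real.exp (if y ∈ S then (Real.exp t - 1) / l else 0)) := by
          refine prod_le_prod (fun i _ => sum_nonneg fun b _ => (Real.exp_pos _).le) fun y _ => ?_
          by_cases hy : y ∈ S
          · simp only [hy, true_and, if_true]
            have h3 : ∑ c : Fin l, Real.exp (if c = b then t else 0) = l + (Real.exp t - 1) := by
              have h4 : ∀ c : Fin l, Real.exp (if c = b then t else 0) =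
                  1 + if c = b then Real.exp t - 1 else 0 := by
                intro c; split_ifs <;> simp
              simp_rw [h4, sum_add_distrib]
              simp
            rw [h3]
            have h5 := Real.add_one_le_exp ((Real.exp t - 1) / l)
            calc (l : ℝ) + (Real.exp t - 1) = l * ((Real.exp t - 1) / l + 1) := by
                  field_simp; ring
              _ ≤ _ := mul_le_mul_of_nonneg_left h5 hl'.le
          · simp [hy]
      _ = Fintype.card (I → Fin l) * Real.exp (#S * ((Real.exp t - 1) / l)) := by
          rw [prod_mul_distrib, ← Real.exp_sum]
          simp
      _ ≤ _ := by
          refine mul_le_mul_of_nonneg_left (Real.exp_le_exp.2 ?_) (Nat.cast_nonneg _)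
          rw [← mul_div_assoc, div_le_iff₀ hl']
          nlinarith
  rw [Real.exp_sub, ← mul_div_assoc, le_div_iff₀ (Real.exp_pos _)]
  exact h1.trans h2

end Concentration

/-! ### From counting failures to the success probability. -/

section Success

theorem successProb_le_one {d : ℕ} (θs : Fin d → ℝ) {n m : ℕ} (𝒢 : PMF (PoolingScheme n m))
    (A : Decoder d) : successProb θs 𝒢 A ≤ 1 := by
  have h1 : ∑ G : PoolingScheme n m, (𝒢 G).toReal = 1 := by
    have h2 := 𝒢.tsum_coe
    rw [tsum_fintype] at h2
    rw [← ENNReal.toReal_sum fun G _ => 𝒢.apply_ne_top G, h2, ENNReal.toReal_one]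
  rw [← h1]
  refine sum_le_sum fun G _ => mul_le_of_le_one_right ENNReal.toReal_nonneg ?_
  exact div_le_one_of_le₀ (Nat.cast_le.2 (card_le_card (filter_subset _ _))) (Nat.cast_nonneg _)

theorem successProb_map_uniform {d : ℕ} (θs : Fin d → ℝ) {n m : ℕ} {Ω : Type} [Fintype Ω]
    [Nonempty Ω] (f : Ω → PoolingScheme n m) (A : Decoder d) :
    successProb θs ((PMF.uniformOfFintype Ω).map f) A =
      (∑ σ ∈ groundTruths θs n, (#{ω | A n m (f ω) (measurement (f ω) σ) = σ} : ℝ)) /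
        (Fintype.card Ω * #(groundTruths θs n)) := by
  classical
  have h1 : ∀ G, (((PMF.uniformOfFintype Ω).map f) G).toReal =
      ∑ ω with f ω = G, (Fintype.card Ω : ℝ)⁻¹ := by
    intro G
    rw [PMF.map_apply, tsum_fintype, sum_filter, ENNReal.toReal_sum]
    · refine sum_congr rfl fun ω _ => ?_
      by_cases h : f ω = G
      · simp [h]
      · simp [h, Ne.symm h]
    · intro ω _
      split_ifs
      · exact PMF.apply_ne_top _ _
      · exact ENNReal.zero_ne_top
  unfold successProb
  simp_rw [h1, sum_mul]
  have h2 : ∀ G, ∑ ω with f ω = G, (Fintype.card Ω : ℝ)⁻¹ *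
      ((#{σ ∈ groundTruths θs n | A n m G (measurement G σ) = σ} : ℝ) / #(groundTruths θs n)) =
      ∑ ω with f ω = G, (Fintype.card Ω : ℝ)⁻¹ *
      ((#{σ ∈ groundTruths θs n | A n m (f ω) (measurement (f ω) σ) = σ} : ℝ) /
        #(groundTruths θs n)) := fun G => sum_congr rfl fun ω hω => by
    rw [(mem_filter.1 hω).2]
  simp_rw [h2]
  rw [sum_fiberwise]
  have h3 : ∑ ω, (#{σ ∈ groundTruths θs n | A n m (f ω) (measurement (f ω) σ) = σ} : ℝ) =
      ∑ σ ∈ groundTruths θs n, (#{ω | A n m (f ω) (measurement (f ω) σ) = σ} : ℝ) := by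
    simp only [card_filter, Nat.cast_sum]
    exact sum_comm
  rw [← h3, ← mul_sum, ← sum_div, inv_mul_eq_div, div_div, mul_comm]

/-- A failure bound that is uniform in the label vector survives averaging, so the randomness of the
ground truth is never exploited. Without `hne` the quotient in `successProb` would be `0 / 0 = 0`.
-/
theorem le_successProb {d : ℕ} (θs : Fin d → ℝ) {n m : ℕ} {Ω : Type} [Fintype Ω]
    [Nonempty Ω] (f : Ω → PoolingScheme n m) (A : Decoder d) (hne : (groundTruths θs n).Nonempty)
    {η : ℝ} (h : ∀ σ ∈ groundTruths θs n,
      (#{ω | A n m (f ω) (measurement (f ω) σ) ≠ σ} : ℝ) ≤ η * Fintype.card Ω) :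
    1 - η ≤ successProb θs ((PMF.uniformOfFintype Ω).map f) A := by
  have hΩ : (0 : ℝ) < Fintype.card Ω := Nat.cast_pos.2 Fintype.card_pos
  have hg : (0 : ℝ) < #(groundTruths θs n) := Nat.cast_pos.2 hne.card_pos
  rw [successProb_map_uniform, le_div_iff₀ (by positivity)]
  have h1 : ∀ σ ∈ groundTruths θs n, (1 - η) * Fintype.card Ω ≤
      (#{ω | A n m (f ω) (measurement (f ω) σ) = σ} : ℝ) := by
    intro σ hσ
    have h2 := h σ hσ
    have h3 := card_filter_add_card_filter_not (s := (univ : Finset Ω))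
      (fun ω => A n m (f ω) (measurement (f ω) σ) = σ)
    have h4 : (#{ω | A n m (f ω) (measurement (f ω) σ) = σ} : ℝ) +
      #{ω | A n m (f ω) (measurement (f ω) σ) ≠ σ} = Fintype.card Ω := by
      rw [← card_univ]; exact_mod_cast h3
    linarith
  have h5 := card_nsmul_le_sum _ _ _ h1
  rw [nsmul_eq_mul] at h5
  linarith

end Success

/-! ### The spatially coupled scheme and its score. -/

section Scheme

variable {n l s M d : ℕ}

/-- The spatially coupled pooling scheme. The items are partitioned into the blocks `β x = 0, …,
l - 1`, and there are `l + s` windows, the window `t` being the union of the blocks `b` with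
`b ≤ t < b + s`. The first `l + s` pools are the windows; then each window has `M` pools, which are
given by the coins `ε`. The last pool consists of the first `l + s` items. -/
def coupledScheme (n l s M : ℕ) (β : Fin n → Fin l)
    (ε : Fin ((l + s) * (M + 1) + 1) × Fin n → Bool) :
    PoolingScheme n ((l + s) * (M + 1) + 1) := fun j =>
  {x | if (j : ℕ) = (l + s) * (M + 1) then (x : ℕ) < l + s else
    ((β x : ℕ) ≤ j % (l + s) ∧ j % (l + s) < β x + s) ∧ (l + s ≤ j → ε (j, x) = true)}

variable (β : Fin n → Fin l) (ε : Fin ((l + s) * (M + 1) + 1) × Fin n → Bool)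

theorem incidence_iff {n m : ℕ} (G : PoolingScheme n m) (j : ℕ) (x : Fin n) :
    incidence G j x ↔ ∃ hj : j < m, x ∈ G ⟨j, hj⟩ :=
  ⟨fun ⟨hj, _, h⟩ => ⟨hj, h⟩, fun ⟨hj, h⟩ => ⟨hj, x.2, h⟩⟩

theorem incidence_window {t : ℕ} (ht : t < l + s) (x : Fin n) :
    incidence (coupledScheme n l s M β ε) t x ↔ (β x : ℕ) ≤ t ∧ t < β x + s := by
  have h1 : l + s ≤ (l + s) * (M + 1) := Nat.le_mul_of_pos_right _ (Nat.succ_pos _)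
  rw [incidence_iff]
  simp only [coupledScheme, mem_filter, mem_univ, true_and, Nat.mod_eq_of_lt ht,
    show t ≠ (l + s) * (M + 1) by omega, if_false, show ¬ (l + s ≤ t) by omega, false_imp_iff,
    and_true]
  exact ⟨fun ⟨_, h⟩ => h, fun h => ⟨by omega, h⟩⟩

theorem incidence_pool {j : ℕ} (hj : l + s ≤ j) (hj' : j + 1 < (l + s) * (M + 1) + 1)
    (hT : 0 < l + s) (x : Fin n) :
    incidence (coupledScheme n l s M β ε) j x ↔
      incidence (coupledScheme n l s M β ε) (j % (l + s)) x ∧ ε (⟨j, by omega⟩, x) = true := by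
  rw [incidence_window _ _ (Nat.mod_lt _ hT), incidence_iff]
  simp only [coupledScheme, mem_filter, mem_univ, true_and,
    show j ≠ (l + s) * (M + 1) by omega, if_false, hj, true_imp_iff]
  exact ⟨fun ⟨_, h⟩ => h, fun h => ⟨by omega, h⟩⟩

theorem incidence_last (x : Fin n) :
    incidence (coupledScheme n l s M β ε) ((l + s) * (M + 1)) x ↔ (x : ℕ) < l + s := by
  rw [incidence_iff]
  simp [coupledScheme]

theorem sum_mod_eq (T M : ℕ) (F : ℕ → ℝ) :
    ∑ j ∈ range (T * (M + 1)), (if T ≤ j then F (j % T) else 0) = M * ∑ t ∈ range T, F t := by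
  induction M with
  | zero =>
    simp only [zero_add, mul_one, Nat.cast_zero, zero_mul]
    exact sum_eq_zero fun j hj => if_neg (by rw [mem_range] at hj; omega)
  | succ M ih =>
    rw [mul_add T (M + 1) 1, mul_one, sum_range_add, ih, Nat.cast_add_one, add_mul, one_mul]
    congr 1
    refine sum_congr rfl fun t ht => ?_
    rw [mem_range] at ht
    have : T ≤ T * (M + 1) + t := (Nat.le_mul_of_pos_right T (Nat.succ_pos M)).trans (Nat.le_add_right _ _)
    rw [if_pos this, Nat.mul_add_mod, Nat.mod_eq_of_lt ht]

-- The pools relevant to `x` are `M` for each of its `s` windows `β x, …, β x + s - 1`, all of which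
-- exist since there are `l + s` windows. Weight sums therefore do not depend on the block of the
-- item.
open Classical in
theorem sum_relevant (hT : 0 < l + s) (x : Fin n) (F : ℕ → ℝ) :
    ∑ j ∈ range ((l + s) * (M + 1) + 1),
      (if Relevant ((l + s) * (M + 1) + 1) (l + s) (incidence (coupledScheme n l s M β ε)) x j
        then F (j % (l + s) + 1 - β x) else 0) = M * ∑ c ∈ range s, F (c + 1) := by
  rw [sum_range_succ, if_neg (by unfold Relevant; omega), add_zero]
  have h1 := sum_mod_eq (l + s) M
    (fun t => if (β x : ℕ) ≤ t ∧ t < β x + s then F (t + 1 - β x) else 0)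
  have h2 : ∑ t ∈ range (l + s), (if (β x : ℕ) ≤ t ∧ t < β x + s then F (t + 1 - β x) else 0) =
      ∑ c ∈ range s, F (c + 1) := by
    rw [← sum_filter]
    refine sum_bij' (fun t _ => t - β x) (fun c _ => β x + c) ?_ ?_ ?_ ?_ ?_
    · intro t ht
      simp only [mem_filter, mem_range] at ht ⊢
      omega
    · intro c hc
      have := (β x).2
      simp only [mem_filter, mem_range] at hc ⊢
      omega
    · intro t ht
      simp only [mem_filter, mem_range] at ht
      omega
    · intro c _; omega
    · intro t ht
      simp only [mem_filter, mem_range] at ht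
      congr 1; omega
  rw [← h2, ← h1]
  refine sum_congr rfl fun j hj => ?_
  rw [mem_range] at hj
  unfold Relevant
  simp only [incidence_window β ε (Nat.mod_lt j hT), show j + 1 < (l + s) * (M + 1) + 1 by omega,
    true_and, ← ite_and]

theorem residual_eq_card {g : ℕ → ℕ → Prop} {lab : ℕ → ℕ} {D : ℕ → Prop} (j ω : ℕ)
    [∀ y : Fin n, Decidable (g j y ∧ ¬ D y ∧ lab y = ω)] :
    residual n g lab D j ω = #{y : Fin n | g j y ∧ ¬ D y ∧ lab y = ω} := by
  classical
  unfold residual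
  rw [card_filter, card_filter, sum_range]
  exact sum_congr rfl fun y _ => by congr

variable (σ : Fin n → Fin (d + 1))

open Classical in
/-- The coefficient of the pool `j` and the item `y` in the score of the item `x` for the
label `i`. -/
noncomputable def scoreCoeff (x : Fin n) (i : ℕ)
    (jy : Fin ((l + s) * (M + 1) + 1) × Fin n) : ℝ :=
  if (l + s ≤ jy.1 ∧ (jy.1 : ℕ) + 1 < (l + s) * (M + 1) + 1 ∧
      ((β x : ℕ) ≤ jy.1 % (l + s) ∧ jy.1 % (l + s) < β x + s)) ∧
      ((β jy.2 : ℕ) ≤ jy.1 % (l + s) ∧ jy.1 % (l + s) < β jy.2 + s) ∧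
      ¬ ((β jy.2 : ℕ) < β x ∨ (β jy.2 : ℕ) = β x ∧ jy.2 < x) ∧ (σ jy.2 : ℕ) = i
  then ((n / (jy.1 % (l + s) + 1 - β x) : ℕ) : ℝ) else 0

/-- An item first appears in the window numbered by its own block, so the decoding order is
lexicographic in block and index. -/
theorem decoded_iff (hs : 0 < s) (x y : Fin n) :
    Decoded (incidence (coupledScheme n l s M β ε)) (β x) x y ↔
      ((β y : ℕ) < β x ∨ (β y : ℕ) = β x ∧ y < x) := by
  have hx := (β x).2
  unfold Decoded
  rw [incidence_window β ε (by omega)]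
  constructor
  · rintro (⟨b, hb, h⟩ | ⟨h1, h2⟩)
    · rw [incidence_window β ε (by omega)] at h
      omega
    · rcases lt_or_eq_of_le h1.1 with h | h
      · exact Or.inl h
      · exact Or.inr ⟨h, h2⟩
  · rintro (h | ⟨h1, h2⟩)
    · refine Or.inl ⟨β y, h, ?_⟩
      rw [incidence_window β ε (by omega)]
      omega
    · exact Or.inr ⟨by omega, h2⟩

/-- Doubling the pool count and subtracting the window count recentres each coin from `{0, 1}` to a
sign; exchanging the two parts in pools that avoid `x` supplies the sign of `x`. The window counts
come from the header pools, so the score is computable from the measurements. -/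
theorem score_eq (hs : 0 < s) (x : Fin n) (i : ℕ) :
    ((∑ j ∈ range ((l + s) * (M + 1) + 1), posTerm n ((l + s) * (M + 1) + 1) (l + s)
        (incidence (coupledScheme n l s M β ε)) (residual n (incidence (coupledScheme n l s M β ε))
          (labelOf σ) (Decoded (incidence (coupledScheme n l s M β ε)) (β x) x)) (β x) x i j : ℕ) : ℝ)
      - (∑ j ∈ range ((l + s) * (M + 1) + 1), negTerm n ((l + s) * (M + 1) + 1) (l + s)
        (incidence (coupledScheme n l s M β ε)) (residual n (incidence (coupledScheme n l s M β ε))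
          (labelOf σ) (Decoded (incidence (coupledScheme n l s M β ε)) (β x) x)) (β x) x i j : ℕ) =
    ∑ jy, scoreCoeff (s := s) (M := M) β σ x i jy *
      (boolSign (ε (jy.1, x)) * boolSign (ε jy)) := by
  classical
  have hT : 0 < l + s := by omega
  push_cast
  rw [← sum_sub_distrib, sum_range, Fintype.sum_prod_type]
  refine sum_congr rfl fun j _ => ?_
  set g := incidence (coupledScheme n l s M β ε) with hg
  have hwin : ∀ y : Fin n, g (j % (l + s)) y ↔
      (β y : ℕ) ≤ j % (l + s) ∧ j % (l + s) < β y + s := fun y => by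
    rw [hg, incidence_window β ε (Nat.mod_lt _ hT)]
  have hlab : ∀ y : Fin n, labelOf σ y = σ y := fun y => by simp [labelOf]
  unfold posTerm negTerm scoreCoeff Relevant
  rw [hwin]
  by_cases hrel : l + s ≤ j ∧ (j : ℕ) + 1 < (l + s) * (M + 1) + 1 ∧
      (β x : ℕ) ≤ j % (l + s) ∧ j % (l + s) < β x + s
  swap
  · simp only [hrel, if_false, false_and, zero_mul, sum_const_zero, Nat.cast_zero, sub_zero]
  have hpool : ∀ y : Fin n, g j y ↔
      ((β y : ℕ) ≤ j % (l + s) ∧ j % (l + s) < β y + s) ∧ ε (j, y) = true := fun y => by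
    rw [hg, incidence_pool β ε hrel.1 hrel.2.1 hT, ← hg, hwin]
  simp only [hrel, if_true, true_and]
  set w := n / (j % (l + s) + 1 - β x) with hw
  have hR : ∀ y : Fin n, ¬ Decoded g (β x) x y ↔
      ¬ ((β y : ℕ) < β x ∨ (β y : ℕ) = β x ∧ y < x) := fun y => by
    rw [hg, decoded_iff β ε hs]
  have hres : (2 * residual n g (labelOf σ) (Decoded g (β x) x) j i : ℝ) -
      residual n g (labelOf σ) (Decoded g (β x) x) (j % (l + s)) i =
      ∑ y : Fin n, if ((β y : ℕ) ≤ j % (l + s) ∧ j % (l + s) < β y + s) ∧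
        ¬ ((β y : ℕ) < β x ∨ (β y : ℕ) = β x ∧ y < x) ∧ (σ y : ℕ) = i
        then boolSign (ε (j, y)) else 0 := by
    rw [residual_eq_card, residual_eq_card, card_filter, card_filter]
    push_cast
    rw [mul_sum, ← sum_sub_distrib]
    refine sum_congr rfl fun y _ => ?_
    simp only [hwin, hpool, hR, hlab]
    by_cases h1 : (β y : ℕ) ≤ j % (l + s) ∧ j % (l + s) < β y + s
    swap
    · simp [h1]
    by_cases h2 : ¬ ((β y : ℕ) < β x ∨ (β y : ℕ) = β x ∧ y < x) ∧ (σ y : ℕ) = i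
    swap
    · simp only [h1, h2, and_false, if_false, mul_zero, sub_zero]
    cases ε (j, y)
    · simp only [h1, h2, boolSign, and_self, and_true, not_false_eq_true, if_true, and_false,
        Bool.false_eq_true, if_false]
      norm_num
    · simp only [h1, h2, boolSign, and_self, not_false_eq_true, if_true]
      norm_num
  have hterm : ((w * (if g j x then 2 * residual n g (labelOf σ) (Decoded g (β x) x) j i
        else residual n g (labelOf σ) (Decoded g (β x) x) (j % (l + s)) i) : ℕ) : ℝ) -
      ((w * (if g j x then residual n g (labelOf σ) (Decoded g (β x) x) (j % (l + s)) i
        else 2 * residual n g (labelOf σ) (Decoded g (β x) x) j i) : ℕ) : ℝ) =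
      w * boolSign (ε (j, x)) * ((2 * residual n g (labelOf σ) (Decoded g (β x) x) j i : ℝ) -
        residual n g (labelOf σ) (Decoded g (β x) x) (j % (l + s)) i) := by
    have : g j x ↔ ε (j, x) = true := by rw [hpool]; exact and_iff_right hrel.2.2
    cases hε : ε (j, x) <;> simp only [this, hε, boolSign] <;> push_cast <;> simp <;> ring
  rw [hterm, hres, mul_sum]
  refine sum_congr rfl fun y _ => ?_
  split_ifs
  · ring
  · simp

end Scheme

/-! ### Signal, variance and error probability of one test. -/

section Tail

variable {n l s M d : ℕ}

/-- The sum of the weights of the windows of an item. -/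
noncomputable def weightSum (n s : ℕ) : ℝ := ∑ c ∈ range s, ((n / (c + 1) : ℕ) : ℝ)

/-- The sum of the squared weights of the windows of an item, multiplied by their lengths. -/
noncomputable def weightSqSum (n s : ℕ) : ℝ :=
  ∑ c ∈ range s, ((n / (c + 1) : ℕ) : ℝ) ^ 2 * (c + 1 : ℕ)

variable (β : Fin n → Fin l) (ε : Fin ((l + s) * (M + 1) + 1) × Fin n → Bool)
variable (σ : Fin n → Fin (d + 1))

theorem sum_totTerm (hT : 0 < l + s) (x : Fin n) :
    ((∑ j ∈ range ((l + s) * (M + 1) + 1), totTerm n ((l + s) * (M + 1) + 1) (l + s)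
      (incidence (coupledScheme n l s M β ε)) (β x) x j : ℕ) : ℝ) = M * weightSum n s := by
  classical
  rw [weightSum, ← sum_relevant β ε hT x (fun c => ((n / c : ℕ) : ℝ))]
  push_cast
  refine sum_congr rfl fun j _ => ?_
  unfold totTerm
  split_ifs <;> simp

/-- The signal. On the diagonal both signs agree and their product is 1, so this part of the score
does not depend on the coins. -/
theorem sum_scoreCoeff_self (hT : 0 < l + s) (x : Fin n) (i : ℕ) :
    ∑ j, scoreCoeff (s := s) (M := M) β σ x i (j, x) =
      if (σ x : ℕ) = i then M * weightSum n s else 0 := by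
  classical
  split_ifs with h
  · rw [weightSum, ← sum_relevant β (fun _ => true) hT x (fun c => ((n / c : ℕ) : ℝ)), sum_range]
    refine sum_congr rfl fun j _ => ?_
    unfold scoreCoeff Relevant
    simp only [incidence_window _ _ (Nat.mod_lt _ hT), h, lt_irrefl, and_false, or_self,
      not_false_eq_true, and_true]
    congr 1
    refine propext ⟨fun h => h.1, fun h => ⟨h, h.2.2⟩⟩
  · refine sum_eq_zero fun j _ => ?_
    unfold scoreCoeff
    simp [h]

theorem card_window_le {κ : ℝ} (i b t : ℕ)
    (hβ : ∀ b, (#{y : Fin n | (σ y : ℕ) = i ∧ (β y : ℕ) = b} : ℝ) ≤ κ) :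
    (#{y : Fin n | (σ y : ℕ) = i ∧ b ≤ (β y : ℕ) ∧ (β y : ℕ) ≤ t} : ℝ) ≤ (t + 1 - b : ℕ) * κ := by
  have h1 : #{y : Fin n | (σ y : ℕ) = i ∧ b ≤ (β y : ℕ) ∧ (β y : ℕ) ≤ t} ≤
      ∑ b' ∈ Icc b t, #{y : Fin n | (σ y : ℕ) = i ∧ (β y : ℕ) = b'} := by
    refine (card_le_card fun y hy => ?_).trans card_biUnion_le
    simp only [mem_filter, mem_univ, true_and, mem_biUnion, mem_Icc] at hy ⊢
    exact ⟨β y, hy.2, hy.1, rfl⟩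
  calc (#{y : Fin n | (σ y : ℕ) = i ∧ b ≤ (β y : ℕ) ∧ (β y : ℕ) ≤ t} : ℝ)
      ≤ ∑ b' ∈ Icc b t, (#{y : Fin n | (σ y : ℕ) = i ∧ (β y : ℕ) = b'} : ℝ) := by exact_mod_cast h1
    _ ≤ ∑ _b' ∈ Icc b t, κ := sum_le_sum fun b' _ => hβ b'
    _ = _ := by rw [sum_const, nsmul_eq_mul, Nat.card_Icc]

/-- This is where sequential decoding pays off: in window `t` only the blocks from `β x` to `t` can
still hold undecoded items, which is `t + 1 - β x` blocks instead of up to `s`. -/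
theorem sum_scoreCoeff_sq_le (hT : 0 < l + s) (x : Fin n) (i : ℕ) {κ : ℝ}
    (hβ : ∀ b, (#{y : Fin n | (σ y : ℕ) = i ∧ (β y : ℕ) = b} : ℝ) ≤ κ) :
    ∑ jy, scoreCoeff (s := s) (M := M) β σ x i jy ^ 2 ≤ M * κ * weightSqSum n s := by
  classical
  have h1 : M * κ * weightSqSum n s =
      M * ∑ c ∈ range s, ((n / (c + 1) : ℕ) : ℝ) ^ 2 * ((c + 1 : ℕ) * κ) := by
    rw [weightSqSum, mul_assoc, mul_sum]
    congr 1
    exact sum_congr rfl fun c _ => by ring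
  rw [h1, ← sum_relevant β (fun _ => true) hT x (fun c => ((n / c : ℕ) : ℝ) ^ 2 * ((c : ℕ) * κ)),
    sum_range, Fintype.sum_prod_type]
  refine sum_le_sum fun j _ => ?_
  unfold Relevant
  simp only [incidence_window _ _ (Nat.mod_lt _ hT)]
  split_ifs with hrel
  · have h2 := card_window_le β σ i (β x) (j % (l + s)) hβ
    refine le_trans ?_ (mul_le_mul_of_nonneg_left h2 (sq_nonneg _))
    rw [card_filter, Nat.cast_sum, mul_sum]
    refine sum_le_sum fun y _ => ?_
    unfold scoreCoeff
    split_ifs with h3 h4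
    · simp
    · refine absurd ⟨h3.2.2.2, ?_⟩ h4
      have h5 := h3.2.2.1
      have h6 := h3.2.1
      simp only at h5 h6 ⊢
      omega
    · rw [zero_pow two_ne_zero]
      exact mul_nonneg (sq_nonneg _) (Nat.cast_nonneg _)
    · simp
  · refine (sum_eq_zero fun y _ => ?_).le
    unfold scoreCoeff
    rw [if_neg (fun h => hrel h.1)]
    simp

/-- Clearing the denominator and moving the negative part across the inequality lets natural number
arithmetic test a rational threshold. -/
theorem accepts_iff {p q : ℕ} (hq : 0 < q) (hs : 0 < s) (x : Fin n) (i : ℕ) :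
    Accepts n ((l + s) * (M + 1) + 1) (l + s) p q (incidence (coupledScheme n l s M β ε))
      (residual n (incidence (coupledScheme n l s M β ε)) (labelOf σ)
        (Decoded (incidence (coupledScheme n l s M β ε)) (β x) x)) (β x) x i ↔
    (p / q : ℝ) * (M * weightSum n s) <
      ∑ jy, scoreCoeff (s := s) (M := M) β σ x i jy *
        (boolSign (ε (jy.1, x)) * boolSign (ε jy)) := by
  have hT : 0 < l + s := by omega
  have hq' : (0 : ℝ) < q := Nat.cast_pos.2 hq
  unfold Accepts
  rw [← score_eq β ε σ hs, ← sum_totTerm β ε hT x, ← Nat.cast_lt (α := ℝ), div_mul_eq_mul_div,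
    div_lt_iff₀ hq']
  simp only [Nat.cast_add, Nat.cast_mul]
  constructor <;> intro h <;> linarith

open Classical in
/-- The probability over the coins that the item `x` is tested wrongly for the label `i`. -/
theorem card_wrong_test_le {p q : ℕ} (hpq : p < q) (hs : 0 < s) (hM : 0 < M)
    (x : Fin n) (i : ℕ) {κ : ℝ} (hκ : 0 < κ)
    (hβ : ∀ b, (#{y : Fin n | (σ y : ℕ) = i ∧ (β y : ℕ) = b} : ℝ) ≤ κ) :
    (#{ε : Fin ((l + s) * (M + 1) + 1) × Fin n → Bool |
      ¬ (Accepts n ((l + s) * (M + 1) + 1) (l + s) p q (incidence (coupledScheme n l s M β ε))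
      (residual n (incidence (coupledScheme n l s M β ε)) (labelOf σ)
        (Decoded (incidence (coupledScheme n l s M β ε)) (β x) x)) (β x) x i ↔ (σ x : ℕ) = i)} : ℝ) ≤
      Fintype.card (Fin ((l + s) * (M + 1) + 1) × Fin n → Bool) *
        Real.exp (-((if (σ x : ℕ) = i then 1 - (p / q : ℝ) else p / q) ^ 2 *
          (M * weightSum n s ^ 2 / (2 * κ * weightSqSum n s)))) := by
  have hT : 0 < l + s := by omega
  have hn : 0 < n := x.pos
  have hq : (0 : ℝ) < q := Nat.cast_pos.2 (by omega)
  have hα : (p / q : ℝ) < 1 := by rw [div_lt_one hq]; exact_mod_cast hpq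
  have hM' : (0 : ℝ) < M := Nat.cast_pos.2 hM
  have hW : 0 ≤ weightSum n s := sum_nonneg fun _ _ => Nat.cast_nonneg _
  have hV : 0 < weightSqSum n s := by
    refine sum_pos' (fun c _ => by positivity) ⟨0, mem_range.2 hs, ?_⟩
    simp only [zero_add, Nat.div_one]
    positivity
  have hB : 0 < M * κ * weightSqSum n s := by positivity
  -- The column of `x` is split off as the deterministic signal; what remains satisfies the
  -- hypothesis of `card_le_of_chaos`.
  set c : Fin ((l + s) * (M + 1) + 1) × Fin n → ℝ := fun jy =>
    if jy.2 = x then 0 else scoreCoeff (s := s) (M := M) β σ x i jy with hc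
  have hcx : ∀ j, c (j, x) = 0 := fun j => by simp [hc]
  have hc2 : ∑ jy, c jy ^ 2 ≤ M * κ * weightSqSum n s := by
    refine (sum_le_sum fun jy _ => ?_).trans (sum_scoreCoeff_sq_le β σ hT x i hβ)
    simp only [hc]
    split_ifs
    · simpa using sq_nonneg _
    · exact le_rfl
  have hsplit : ∀ ε : Fin ((l + s) * (M + 1) + 1) × Fin n → Bool,
      ∑ jy, scoreCoeff (s := s) (M := M) β σ x i jy * (boolSign (ε (jy.1, x)) * boolSign (ε jy)) =
      (if (σ x : ℕ) = i then M * weightSum n s else 0) +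
        ∑ jy, c jy * (boolSign (ε (jy.1, x)) * boolSign (ε jy)) := by
    intro ε
    have hsq : ∀ b : Bool, boolSign b * boolSign b = 1 := by intro b; cases b <;> simp [boolSign]
    rw [← sum_scoreCoeff_self β σ hT x i, Fintype.sum_prod_type, Fintype.sum_prod_type,
      ← sum_add_distrib]
    refine sum_congr rfl fun j _ => ?_
    rw [← add_sum_erase _ _ (mem_univ x), ← add_sum_erase (f := fun y => c (j, y) * _) _ (mem_univ x)]
    simp only [hcx, hsq, mul_one, zero_add]
    congr 1
    refine sum_congr rfl fun y hy => ?_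
    simp only [hc, if_neg (ne_of_mem_erase hy)]
  simp_rw [accepts_iff β _ σ (by omega : 0 < q) hs x i, hsplit]
  by_cases hi : (σ x : ℕ) = i
  · simp only [hi, if_true, iff_true, not_lt]
    -- A miss forces the noise down to at most `-(1 - p / q)` times the signal; this lower tail is
    -- an upper tail for `-c`.
    have h1 := card_le_of_chaos x (fun jy => - c jy) (by simpa using hcx)
      (a := (1 - p / q) * (M * weightSum n s)) (by have := sub_pos.2 hα; positivity) hB
      (by simpa using hc2)
    refine le_trans (Nat.cast_le.2 (card_le_card fun ε hε => ?_)) (h1.trans (le_of_eq ?_))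
    · simp only [mem_filter, mem_univ, true_and, neg_mul, sum_neg_distrib] at hε ⊢
      linarith
    · congr 3
      field_simp
  · simp only [hi, if_false, iff_false, not_not, zero_add]
    have h1 := card_le_of_chaos x c hcx
      (a := (p / q) * (M * weightSum n s)) (by positivity) hB hc2
    refine le_trans (Nat.cast_le.2 (card_le_card fun ε hε => ?_)) (h1.trans (le_of_eq ?_))
    · simp only [mem_filter, mem_univ, true_and] at hε ⊢
      exact hε.le
    · congr 3
      field_simp

end Tail

/-! ### Union bound over labels, blocks and items. -/

section Union

/-- Conditioning on the partition into blocks, with the coins still uniform. -/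
theorem card_filter_prod_le {B E : Type*} [Fintype B] [Fintype E] (P : B × E → Prop)
    [DecidablePred P] {K : ℝ} (h : ∀ β, (#{ε | P (β, ε)} : ℝ) ≤ K) :
    (#{ω | P ω} : ℝ) ≤ Fintype.card B * K := by
  have h1 : (#{ω | P ω} : ℝ) = ∑ β, (#{ε | P (β, ε)} : ℝ) := by
    simp only [card_filter]
    rw [Fintype.sum_prod_type, Nat.cast_sum]
  rw [h1, ← card_univ, ← nsmul_eq_mul]
  exact sum_le_card_nsmul _ _ _ fun β _ => h β

variable {n l s M d p q : ℕ}

/-- The first pool that contains `x` is window `β x`, so `h` covers every visit on which an item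
gets decoded. By `l + s ≤ n` the last pool really has `l + s` items. -/
theorem thresholdDecoder_coupledScheme (hs : 0 < s) (hT : l + s ≤ n)
    (β : Fin n → Fin l) (ε : Fin ((l + s) * (M + 1) + 1) × Fin n → Bool)
    (σ : Fin n → Fin (d + 1))
    (h : ∀ (x : Fin n) (i : Fin d),
      Accepts n ((l + s) * (M + 1) + 1) (l + s) p q (incidence (coupledScheme n l s M β ε))
      (residual n (incidence (coupledScheme n l s M β ε)) (labelOf σ)
        (Decoded (incidence (coupledScheme n l s M β ε)) (β x) x)) (β x) x (i + 1) ↔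
        (σ x : ℕ) = i + 1) :
    thresholdDecoder d p q n ((l + s) * (M + 1) + 1) (coupledScheme n l s M β ε)
      (measurement (coupledScheme n l s M β ε) σ) = σ := by
  have hm : l + s ≤ (l + s) * (M + 1) := Nat.le_mul_of_pos_right _ (Nat.succ_pos _)
  refine thresholdDecoder_eq (T := l + s) _ σ ?_ ?_ ?_
  · intro _
    have h1 : {x ∈ range n | incidence (coupledScheme n l s M β ε) ((l + s) * (M + 1) + 1 - 1) x} =
        range (l + s) := by
      ext x
      simp only [mem_filter, mem_range]
      constructor
      · rintro ⟨hx, h⟩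
        exact (incidence_last β ε ⟨x, hx⟩).1 h
      · intro hx
        exact ⟨by omega, (incidence_last β ε ⟨x, by omega⟩).2 hx⟩
    rw [h1, card_range]
  · intro x hx
    have := (β ⟨x, hx⟩).2
    exact ⟨β ⟨x, hx⟩, by omega, (incidence_window β ε (by omega) ⟨x, hx⟩).2 (by omega)⟩
  · intro b _ x hx hb hb' i hi hid
    have hβ := (β ⟨x, hx⟩).2
    have h1 : b ≤ β ⟨x, hx⟩ := by
      by_contra! hlt
      exact hb' _ hlt ((incidence_window β ε (by omega) ⟨x, hx⟩).2 (by omega))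
    have h2 := ((incidence_window β ε (by omega) ⟨x, hx⟩).1 hb).1
    have h3 : b = β ⟨x, hx⟩ := by omega
    subst h3
    have h4 := h ⟨x, hx⟩ ⟨i - 1, by omega⟩
    rw [show ((⟨i - 1, by omega⟩ : Fin d) : ℕ) + 1 = i from Nat.sub_add_cancel hi] at h4
    rw [labelOf, dif_pos hx]
    exact h4

/-- The probability that the threshold decoder fails on a given label vector. -/
theorem card_decoding_failure_le (hpq : p < q) (hs : 0 < s) (hM : 0 < M) (hl : 0 < l)
    (hT : l + s ≤ n) {k : ℕ} {κ μ t : ℝ} (hκ : 0 < κ) (ht : 0 ≤ t) (hμ : (k : ℝ) ≤ μ * l)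
    (σ : Fin n → Fin (d + 1)) (hσ : ∀ i : Fin d, #{x | σ x = i.succ} ≤ k) :
    (#{ω : (Fin n → Fin l) × (Fin ((l + s) * (M + 1) + 1) × Fin n → Bool) |
      thresholdDecoder d p q n ((l + s) * (M + 1) + 1) (coupledScheme n l s M ω.1 ω.2)
        (measurement (coupledScheme n l s M ω.1 ω.2) σ) ≠ σ} : ℝ) ≤
    d * (l * Real.exp (μ * (Real.exp t - 1) - t * κ) +
      (n * Real.exp (-((p / q : ℝ) ^ 2 *
        (M * weightSum n s ^ 2 / (2 * κ * weightSqSum n s)))) +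
      k * Real.exp (-((1 - p / q : ℝ) ^ 2 *
        (M * weightSum n s ^ 2 / (2 * κ * weightSqSum n s)))))) *
    Fintype.card ((Fin n → Fin l) × (Fin ((l + s) * (M + 1) + 1) × Fin n → Bool)) := by
  classical
  set E := Fin ((l + s) * (M + 1) + 1) × Fin n → Bool with hE
  set B := Fin n → Fin l with hB
  set e1 := Real.exp (-((p / q : ℝ) ^ 2 * (M * weightSum n s ^ 2 / (2 * κ * weightSqSum n s))))
  set e2 := Real.exp (-((1 - p / q : ℝ) ^ 2 *
    (M * weightSum n s ^ 2 / (2 * κ * weightSqSum n s))))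
  set e0 := Real.exp (μ * (Real.exp t - 1) - t * κ)
  set S : Fin d → Finset (Fin n) := fun i => {x | σ x = i.succ} with hS
  set Wrong : Fin d → Fin n → B → E → Prop := fun i x β ε =>
    ¬ (Accepts n ((l + s) * (M + 1) + 1) (l + s) p q (incidence (coupledScheme n l s M β ε))
      (residual n (incidence (coupledScheme n l s M β ε)) (labelOf σ)
        (Decoded (incidence (coupledScheme n l s M β ε)) (β x) x)) (β x) x (i + 1) ↔
        (σ x : ℕ) = i + 1) with hWrong
  set Bal : Fin d → B → Prop := fun i β => ∀ b : Fin l, (#{y ∈ S i | β y = b} : ℝ) ≤ κ with hBal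
  have hsucc : ∀ (x : Fin n) (i : Fin d), σ x = i.succ ↔ (σ x : ℕ) = i + 1 := fun x i => by
    rw [Fin.ext_iff, Fin.val_succ]
  have hcard : (Fintype.card (B × E) : ℝ) = Fintype.card B * Fintype.card E := by
    rw [Fintype.card_prod, Nat.cast_mul]
  have hE0 : (0 : ℝ) < Fintype.card E := Nat.cast_pos.2 Fintype.card_pos
  have hunbal : ∀ (i : Fin d) (b : Fin l),
      (#{ω : B × E | κ < #{y ∈ S i | ω.1 y = b}} : ℝ) ≤ e0 * Fintype.card (B × E) := by
    intro i b
    have h1 := card_le_of_block hl (S i) b (κ := κ) ht ((Nat.cast_le.2 (hσ i)).trans hμ)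
    have h2 : #{ω : B × E | κ < #{y ∈ S i | ω.1 y = b}} =
        #{β : B | κ < #{y ∈ S i | β y = b}} * Fintype.card E := by
      rw [← card_univ, ← card_product]
      congr 1
      ext ω
      simp
    rw [h2, hcard]
    push_cast
    calc _ ≤ (Fintype.card B * e0) * (Fintype.card E : ℝ) :=
          mul_le_mul_of_nonneg_right h1 hE0.le
      _ = _ := by ring
  -- False positives are charged to all `n` items, misses only to the at most `k` items with the
  -- label. This asymmetry is the source of `1` and `√θ` in `1 + √θ`.
  have hwrong : ∀ (i : Fin d) (x : Fin n),
      (#{ω : B × E | Bal i ω.1 ∧ Wrong i x ω.1 ω.2} : ℝ) ≤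
        (e1 + if x ∈ S i then e2 else 0) * Fintype.card (B × E) := by
    intro i x
    have h1 := card_filter_prod_le (fun ω : B × E => Bal i ω.1 ∧ Wrong i x ω.1 ω.2)
      (K := Fintype.card E * (e1 + if x ∈ S i then e2 else 0)) (by
      intro β
      have hnn : 0 ≤ e1 + if x ∈ S i then e2 else 0 := by
        split_ifs <;> positivity
      by_cases hb : Bal i β
      swap
      · simp only [hb, false_and, filter_false, card_empty, Nat.cast_zero]
        positivity
      have hb' : ∀ b : ℕ, (#{y : Fin n | (σ y : ℕ) = i + 1 ∧ (β y : ℕ) = b} : ℝ) ≤ κ := by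
        intro b
        by_cases hbl : b < l
        · refine le_trans (le_of_eq ?_) (hb ⟨b, hbl⟩)
          congr 2
          ext y
          simp [hS, hsucc, Fin.ext_iff]
        · rw [filter_false_of_mem]
          · simpa using hκ.le
          · rintro y - ⟨-, h⟩
            have := (β y).2
            omega
      have h2 := card_wrong_test_le β σ hpq hs hM x (i + 1) hκ hb'
      simp only [hb, true_and]
      refine h2.trans (mul_le_mul_of_nonneg_left ?_ hE0.le)
      have hxS : x ∈ S i ↔ (σ x : ℕ) = i + 1 := by simp [hS, hsucc]
      have he1 : 0 < e1 := Real.exp_pos _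
      simp only [hxS]
      split_ifs
      · exact le_add_of_nonneg_left he1.le
      · exact le_of_eq (add_zero _).symm)
    refine h1.trans (le_of_eq ?_)
    rw [hcard]; ring
  have hsub : ({ω : B × E | thresholdDecoder d p q n ((l + s) * (M + 1) + 1)
      (coupledScheme n l s M ω.1 ω.2) (measurement (coupledScheme n l s M ω.1 ω.2) σ) ≠ σ} :
      Finset (B × E)) ⊆ univ.biUnion fun i : Fin d =>
        (univ.biUnion fun b : Fin l => {ω : B × E | κ < #{y ∈ S i | ω.1 y = b}}) ∪
        (univ.biUnion fun x : Fin n => {ω : B × E | Bal i ω.1 ∧ Wrong i x ω.1 ω.2}) := by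
    intro ω hω
    simp only [mem_filter, mem_univ, true_and, mem_biUnion, mem_union] at hω ⊢
    by_contra! hcon
    refine hω (thresholdDecoder_coupledScheme hs hT ω.1 ω.2 σ fun x i => ?_)
    have h1 := (hcon i).2 x (hcon i).1
    simp only [hWrong, not_not] at h1
    exact h1
  have hfin : ∀ i : Fin d,
      (#((univ.biUnion fun b : Fin l => ({ω : B × E | κ < #{y ∈ S i | ω.1 y = b}} : Finset _)) ∪
        (univ.biUnion fun x : Fin n =>
          ({ω : B × E | Bal i ω.1 ∧ Wrong i x ω.1 ω.2} : Finset _))) : ℝ) ≤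
      (l * e0 + (n * e1 + k * e2)) * Fintype.card (B × E) := by
    intro i
    calc _ ≤ ∑ b : Fin l, (#{ω : B × E | κ < #{y ∈ S i | ω.1 y = b}} : ℝ) +
          ∑ x : Fin n, (#{ω : B × E | Bal i ω.1 ∧ Wrong i x ω.1 ω.2} : ℝ) := by
          exact_mod_cast (card_union_le _ _).trans (add_le_add card_biUnion_le card_biUnion_le)
      _ ≤ ∑ _b : Fin l, e0 * (Fintype.card (B × E) : ℝ) +
          ∑ x : Fin n, (e1 + if x ∈ S i then e2 else 0) * (Fintype.card (B × E) : ℝ) :=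
          add_le_add (sum_le_sum fun b _ => hunbal i b) (sum_le_sum fun x _ => hwrong i x)
      _ = (l * e0 + (n * e1 + #(S i) * e2)) * Fintype.card (B × E) := by
          rw [← sum_mul, ← sum_mul, sum_add_distrib, ← sum_filter, filter_mem_eq_inter, univ_inter,
            sum_const, sum_const, sum_const]
          simp only [card_univ, Fintype.card_fin, nsmul_eq_mul]
          ring
      _ ≤ _ := by
          have : (#(S i) : ℝ) ≤ k := Nat.cast_le.2 (hσ i)
          gcongr
  calc _ ≤ ∑ i : Fin d, (l * e0 + (n * e1 + k * e2)) * (Fintype.card (B × E) : ℝ) := by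
        refine le_trans ?_ (sum_le_sum fun i _ => hfin i)
        exact_mod_cast (card_le_card hsub).trans card_biUnion_le
    _ = _ := by
        rw [sum_const, card_univ, Fintype.card_fin, nsmul_eq_mul]
        ring

end Union

/-! ### Choice of parameters and growth estimates. -/

section Asymptotics

theorem groundTruths_nonempty {d : ℕ} (θs : Fin d → ℝ) {n : ℕ}
    (h : ∑ i, labelCount (θs i) n ≤ n) : (groundTruths θs n).Nonempty := by
  classical
  have hcard : Fintype.card (Σ i : Fin d, Fin (labelCount (θs i) n)) ≤ Fintype.card (Fin n) := by
    simpa using h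
  obtain ⟨e⟩ := Function.Embedding.nonempty_of_card_le hcard
  refine ⟨fun x => if hx : ∃ p, e p = x then hx.choose.1.succ else 0, ?_⟩
  simp only [groundTruths, mem_filter, mem_univ, true_and]
  intro i
  have h1 : ({x | (if hx : ∃ p, e p = x then hx.choose.1.succ else (0 : Fin (d + 1))) = i.succ} :
      Finset (Fin n)) = univ.image fun c : Fin (labelCount (θs i) n) => e ⟨i, c⟩ := by
    ext x
    simp only [mem_filter, mem_univ, true_and, mem_image]
    constructor
    · intro hx
      split_ifs at hx with hp
      · rw [Fin.succ_inj] at hx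
        refine ⟨hx ▸ hp.choose.2, ?_⟩
        conv_rhs => rw [← hp.choose_spec]
        congr 1
        generalize hp.choose = p at hx
        subst hx
        rfl
      · exact absurd hx (Fin.succ_ne_zero i).symm
    · rintro ⟨c, rfl⟩
      have hp : ∃ p, e p = e ⟨i, c⟩ := ⟨_, rfl⟩
      rw [dif_pos hp, e.injective hp.choose_spec]
  rw [h1, card_image_of_injective _ fun c c' hc => by simpa using e.injective hc, card_univ,
    Fintype.card_fin]

theorem labelCount_mono {θ θ' : ℝ} (h : θ ≤ θ') {n : ℕ} (hn : 1 ≤ n) :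
    labelCount θ n ≤ labelCount θ' n :=
  Nat.floor_mono (Real.rpow_le_rpow_of_exponent_le (by exact_mod_cast hn) h)

/-- For the exact weights `n / c`, both `W / n` and `V / n²` equal the harmonic number `H ≥ log s`.
Rounding down costs at most `s ≤ n` in `W` and only decreases `V`; then `(H - 1)² ≥ (H - 2) H`
finishes. -/
theorem log_sub_two_le_weight_ratio {n s : ℕ} (hs : 0 < s) (hsn : s ≤ n) :
    Real.log s - 2 ≤ weightSum n s ^ 2 / weightSqSum n s := by
  have hn : (0 : ℝ) < n := Nat.cast_pos.2 (by omega)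
  have hV : 0 < weightSqSum n s := by
    refine sum_pos' (fun c _ => by positivity) ⟨0, mem_range.2 hs, ?_⟩
    simp only [zero_add, Nat.div_one]
    positivity
  set H : ℝ := ∑ c ∈ range s, ((c : ℝ) + 1)⁻¹ with hH
  have hlog : Real.log s ≤ H := by
    have h1 := log_add_one_le_harmonic s
    have h2 : ((harmonic s : ℚ) : ℝ) = H := by
      rw [harmonic, hH]; push_cast; rfl
    rw [h2] at h1
    exact (Real.log_le_log (Nat.cast_pos.2 hs) (by exact_mod_cast Nat.le_succ s)).trans h1
  have hW : n * (H - 1) ≤ weightSum n s := by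
    have h1 : ∀ c ∈ range s, (n : ℝ) * ((c : ℝ) + 1)⁻¹ - 1 ≤ ((n / (c + 1) : ℕ) : ℝ) := by
      intro c _
      have h2 := Nat.lt_floor_add_one ((n : ℝ) / ((c + 1 : ℕ) : ℝ))
      rw [Nat.floor_div_eq_div] at h2
      rw [← div_eq_mul_inv]
      push_cast at h2
      linarith
    have h2 := sum_le_sum h1
    rw [sum_sub_distrib, ← mul_sum, sum_const, card_range, nsmul_eq_mul, mul_one] at h2
    have h3 : (s : ℝ) ≤ n := Nat.cast_le.2 hsn
    rw [weightSum]
    linarith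
  have hV2 : weightSqSum n s ≤ n ^ 2 * H := by
    rw [hH, mul_sum]
    refine sum_le_sum fun c _ => ?_
    have h1 : ((n / (c + 1) : ℕ) : ℝ) ≤ n / ((c : ℝ) + 1) := by
      have := @Nat.cast_div_le ℝ _ _ _ n (c + 1)
      push_cast at this
      exact this
    calc ((n / (c + 1) : ℕ) : ℝ) ^ 2 * (c + 1 : ℕ) ≤ (n / ((c : ℝ) + 1)) ^ 2 * (c + 1) := by
          push_cast
          gcongr
      _ = n ^ 2 * ((c : ℝ) + 1)⁻¹ := by field_simp
  rw [le_div_iff₀ hV]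
  rcases le_total H 2 with h | h
  · exact (mul_nonpos_of_nonpos_of_nonneg (by linarith) hV.le).trans (sq_nonneg _)
  · calc (Real.log s - 2) * weightSqSum n s ≤ (H - 2) * (n ^ 2 * H) := by
          apply mul_le_mul (by linarith) hV2 hV.le (by linarith)
      _ ≤ (n * (H - 1)) ^ 2 := by nlinarith [sq_nonneg (n : ℝ)]
      _ ≤ _ := by
          apply pow_le_pow_left₀ (mul_nonneg hn.le (by linarith)) hW

/-- The choice of the numbers `l` of blocks, `s` of windows per item and `M` of pools per window. -/
theorem exists_design_parameters {a C : ℝ} (ha : 0 < a) (hC : 0 < C) :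
    ∃ L₀ : ℕ, ∀ L ≥ L₀, ∀ k : ℕ, L ^ 4 ≤ k → ∃ l s M : ℕ, 0 < l ∧ 0 < s ∧ 0 < M ∧ l + s ≤ k ∧
      (L : ℝ) ^ 2 ≤ k / l ∧ (k : ℝ) / L ^ 3 - 1 ≤ s ∧
      (((l + s) * (M + 1) + 1 : ℕ) : ℝ) ≤ (1 + a) ^ 6 * C * k ∧
      (1 + a) ^ 4 * C ≤ M * l / k := by
  -- `D` lies strictly between the two target constants, so rounding errors that vanish as `L` grows
  -- do no harm.
  set D := (1 + a) ^ 5 * C with hD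
  have hD0 : 0 < D := by positivity
  have hinv : Tendsto (fun L : ℕ => ((L : ℝ))⁻¹) atTop (𝓝 0) := tendsto_inv_atTop_nhds_zero_nat
  have hup : Tendsto (fun L : ℕ => (1 + ((L : ℝ))⁻¹) * (D + ((L : ℝ))⁻¹ ^ 2) + ((L : ℝ))⁻¹ ^ 2)
      atTop (𝓝 D) := by
    have := ((hinv.const_add 1).mul ((hinv.pow 2).const_add D)).add (hinv.pow 2)
    simpa using this
  have hlow : Tendsto (fun L : ℕ => (D - ((L : ℝ))⁻¹ ^ 2) * (1 - ((L : ℝ))⁻¹ ^ 2))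
      atTop (𝓝 D) := by
    have := ((hinv.pow 2).const_sub D).mul ((hinv.pow 2).const_sub 1)
    simpa using this
  have h1a : 1 < 1 + a := by linarith
  have h1 : D < (1 + a) ^ 6 * C := by
    have : (1 + a) ^ 6 * C = (1 + a) * D := by rw [hD]; ring
    nlinarith
  have h2 : (1 + a) ^ 4 * C < D := by
    have : D = (1 + a) * ((1 + a) ^ 4 * C) := by rw [hD]; ring
    have : 0 < (1 + a) ^ 4 * C := by positivity
    nlinarith
  obtain ⟨L₁, hL₁⟩ := eventually_atTop.1 ((hup.eventually_le_const h1).and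
    ((hlow.eventually_const_le h2).and ((hinv.pow 2).eventually_lt_const
      (show (0 : ℝ) ^ 2 < D by simpa using hD0))))
  refine ⟨max L₁ 2, fun L hL k hk => ?_⟩
  have hL2 : 2 ≤ L := le_trans (le_max_right _ _) hL
  obtain ⟨e1, e2, e3⟩ := hL₁ L (le_trans (le_max_left _ _) hL)
  have hLr : (2 : ℝ) ≤ L := by exact_mod_cast hL2
  have hL0 : (0 : ℝ) < L := by linarith
  have hkr : (L : ℝ) ^ 4 ≤ k := by exact_mod_cast hk
  have hk0 : (0 : ℝ) < k := lt_of_lt_of_le (by positivity) hkr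
  have hk2 : L ^ 2 ≤ k := (Nat.pow_le_pow_right (by omega) (by omega)).trans hk
  have hk3 : L ^ 3 ≤ k := (Nat.pow_le_pow_right (by omega) (by omega)).trans hk
  -- A block gets about `L ^ 2` items of a label with `k` items, enough for balance; the `s ≤ l / L`
  -- extra windows cost a factor of at most `1 + 1 / L`; and `M` is dictated by `M l ≈ D k`.
  set l := k / L ^ 2 with hl
  set s := k / L ^ 3 with hs
  set M := ⌊D * (L : ℝ) ^ 2⌋₊ with hM
  have hl0 : 0 < l := Nat.div_pos hk2 (by positivity)
  have hs0 : 0 < s := Nat.div_pos hk3 (by positivity)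
  have hl_le : (l : ℝ) * L ^ 2 ≤ k := by exact_mod_cast Nat.div_mul_le_self k (L ^ 2)
  have hsl : (s : ℝ) ≤ l * (L : ℝ)⁻¹ := by
    have : s = l / L := by rw [hs, hl, Nat.div_div_eq_div_mul, ← pow_succ]
    rw [this, ← div_eq_mul_inv]
    exact Nat.cast_div_le
  have hfloor : ∀ j : ℕ, (k : ℝ) / (L : ℝ) ^ j - 1 ≤ ((k / L ^ j : ℕ) : ℝ) := by
    intro j
    have h3 := Nat.lt_floor_add_one ((k : ℝ) / ((L ^ j : ℕ) : ℝ))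
    rw [Nat.floor_div_eq_div] at h3
    push_cast at h3
    linarith
  have hM_le : (M : ℝ) ≤ D * L ^ 2 := Nat.floor_le (by positivity)
  have hM_ge : D * L ^ 2 - 1 ≤ M := (Nat.sub_one_lt_floor _).le
  have hDL : 1 < D * (L : ℝ) ^ 2 := by
    rw [inv_pow] at e3
    have := (inv_lt_iff_one_lt_mul₀ (by positivity : (0 : ℝ) < (L : ℝ) ^ 2)).1 e3
    linarith
  have hlr : (0 : ℝ) < l := Nat.cast_pos.2 hl0
  refine ⟨l, s, M, hl0, hs0, ?_, ?_, ?_, hfloor 3, ?_, ?_⟩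
  · exact Nat.floor_pos.2 hDL.le
  · have h3 : (l : ℝ) + s ≤ k := by
      have h4 : (l : ℝ) * (L : ℝ)⁻¹ ≤ l * 1 :=
        mul_le_mul_of_nonneg_left (inv_le_one_of_one_le₀ (by linarith)) hlr.le
      have h5 : (l : ℝ) * 2 ^ 2 ≤ l * (L : ℝ) ^ 2 := by gcongr
      linarith
    exact_mod_cast h3
  · rwa [le_div_iff₀ hlr, mul_comm]
  · refine le_trans ?_ (mul_le_mul_of_nonneg_right e1 hk0.le)
    push_cast
    have h3 : (l : ℝ) ≤ k * (L : ℝ)⁻¹ ^ 2 := by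
      rw [inv_pow, ← div_eq_mul_inv, le_div_iff₀ (by positivity)]; exact hl_le
    have h4 : (1 : ℝ) ≤ (L : ℝ)⁻¹ ^ 2 * k := by
      rw [inv_pow, inv_mul_eq_div, le_div_iff₀ (by positivity), one_mul]
      exact_mod_cast hk2
    have h5 : (M : ℝ) + 1 ≤ (D + (L : ℝ)⁻¹ ^ 2) * L ^ 2 := by
      have : (L : ℝ)⁻¹ ^ 2 * L ^ 2 = 1 := by
        rw [← mul_pow, inv_mul_cancel₀ hL0.ne', one_pow]
      nlinarith
    have h6 : ((l : ℝ) + s) ≤ l * (1 + (L : ℝ)⁻¹) := by linarith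
    calc ((l : ℝ) + s) * (M + 1) + 1 ≤
        (l * (1 + (L : ℝ)⁻¹)) * ((D + (L : ℝ)⁻¹ ^ 2) * L ^ 2) + (L : ℝ)⁻¹ ^ 2 * k := by gcongr
      _ = ((1 + (L : ℝ)⁻¹) * (D + (L : ℝ)⁻¹ ^ 2)) * (l * L ^ 2) + (L : ℝ)⁻¹ ^ 2 * k := by ring
      _ ≤ ((1 + (L : ℝ)⁻¹) * (D + (L : ℝ)⁻¹ ^ 2)) * k + (L : ℝ)⁻¹ ^ 2 * k := by gcongr
      _ = _ := by ring
  · refine e2.trans ?_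
    rw [le_div_iff₀ hk0]
    have h3 : (D - (L : ℝ)⁻¹ ^ 2) * L ^ 2 ≤ M := by
      have : (L : ℝ)⁻¹ ^ 2 * L ^ 2 = 1 := by
        rw [← mul_pow, inv_mul_cancel₀ hL0.ne', one_pow]
      nlinarith
    have h4 : (1 - (L : ℝ)⁻¹ ^ 2) * k ≤ l * L ^ 2 := by
      have h5 := hfloor 2
      rw [← hl, sub_le_iff_le_add, div_le_iff₀ (by positivity)] at h5
      have h6 : (L : ℝ) ^ 2 ≤ (L : ℝ)⁻¹ ^ 2 * k := by
        rw [inv_pow, inv_mul_eq_div, le_div_iff₀ (by positivity)]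
        have : (L : ℝ) ^ 2 * (L : ℝ) ^ 2 = (L : ℝ) ^ 4 := by ring
        linarith
      linarith
    have h7 : 0 ≤ D - (L : ℝ)⁻¹ ^ 2 := by linarith
    have hLL : (0 : ℝ) < (L : ℝ) ^ 2 := by positivity
    have h8 : (D - (L : ℝ)⁻¹ ^ 2) * ((1 - (L : ℝ)⁻¹ ^ 2) * k) ≤
        (D - (L : ℝ)⁻¹ ^ 2) * (l * L ^ 2) := mul_le_mul_of_nonneg_left h4 h7
    have h9 : ((D - (L : ℝ)⁻¹ ^ 2) * L ^ 2) * l ≤ M * l := mul_le_mul_of_nonneg_right h3 hlr.le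
    nlinarith

/-- The number of defective items grows faster than `n ^ θ' * (log n) ^ 4` for `θ' < θ`. -/
theorem eventually_le_labelCount {θ θ' : ℝ} (h : θ' < θ) (hθ' : 0 ≤ θ') :
    ∀ᶠ n : ℕ in atTop, (n : ℝ) ^ θ' * Real.log n ^ 4 ≤ labelCount θ n := by
  have h1 : Tendsto (fun x : ℝ => Real.log x ^ (4 : ℝ) / x ^ (θ - θ')) atTop (𝓝 0) :=
    (isLittleO_log_rpow_rpow_atTop 4 (sub_pos.2 h)).tendsto_div_nhds_zero
  have h2 := (h1.comp tendsto_natCast_atTop_atTop).eventually_le_const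
    (show (0 : ℝ) < 1 / 2 by norm_num)
  have h3 : Tendsto (fun n : ℕ => (n : ℝ) ^ θ) atTop atTop :=
    (tendsto_rpow_atTop (by linarith)).comp tendsto_natCast_atTop_atTop
  filter_upwards [h2, h3.eventually_ge_atTop 2, eventually_ge_atTop 1] with n hn hn2 hn1
  have hn0 : (0 : ℝ) < n := Nat.cast_pos.2 (by omega)
  simp only [Function.comp] at hn
  rw [div_le_iff₀ (Real.rpow_pos_of_pos hn0 _)] at hn
  have h4 : Real.log n ^ (4 : ℝ) = Real.log n ^ 4 := by norm_cast
  rw [h4] at hn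
  have h5 : (n : ℝ) ^ θ' * (n : ℝ) ^ (θ - θ') = (n : ℝ) ^ θ := by
    rw [← Real.rpow_add hn0]; congr 1; ring
  have h6 := mul_le_mul_of_nonneg_left hn (Real.rpow_pos_of_pos hn0 θ').le
  have h7 := (Nat.sub_one_lt_floor ((n : ℝ) ^ θ)).le
  unfold labelCount
  nlinarith

theorem tendsto_mul_exp_neg_sq {c : ℝ} (hc : 0 < c) :
    Tendsto (fun n : ℕ => (n : ℝ) * Real.exp (-(c * (Real.log n - 1) ^ 2))) atTop (𝓝 0) := by
  have hlog : Tendsto (fun n : ℕ => Real.log n) atTop atTop :=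
    Real.tendsto_log_atTop.comp tendsto_natCast_atTop_atTop
  have h1 : ∀ᶠ n : ℕ in atTop, (n : ℝ) * Real.exp (-(c * (Real.log n - 1) ^ 2)) ≤
      Real.exp (-Real.log n) := by
    filter_upwards [hlog.eventually_ge_atTop (2 + 4 / c), eventually_ge_atTop 1] with n hn hn1
    have hn0 : (0 : ℝ) < n := Nat.cast_pos.2 (by omega)
    have h2 : (n : ℝ) = Real.exp (Real.log n) := (Real.exp_log hn0).symm
    conv_lhs => rw [h2, Real.log_exp, ← Real.exp_add]
    refine Real.exp_le_exp.2 ?_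
    have h3 : 4 / c ≤ Real.log n - 2 := by linarith
    rw [div_le_iff₀ hc] at h3
    have h4 : 0 < 4 / c := by positivity
    nlinarith [mul_nonneg hc.le (show 0 ≤ Real.log n by linarith)]
  refine squeeze_zero' (Eventually.of_forall fun n => by positivity) h1 ?_
  exact Real.tendsto_exp_atBot.comp (tendsto_neg_atTop_atBot.comp hlog)

theorem tendsto_rpow_neg_nat {c : ℝ} (hc : c < 0) :
    Tendsto (fun n : ℕ => (n : ℝ) ^ c) atTop (𝓝 0) := by
  have := (tendsto_rpow_neg_atTop (neg_pos.2 hc)).comp (tendsto_natCast_atTop_atTop (R := ℝ))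
  simpa [Function.comp_def] using this

end Asymptotics

/-! ### The failure probability of the coupled scheme. -/

section Main

/-- A bound for the failure probability of the coupled scheme whose parameters satisfy the
inequalities of `exists_design_parameters`. -/
theorem failure_bound_le {n l s M k : ℕ} {a r α θ c₁ c₂ : ℝ} (ha : 0 < a) (ha1 : a ≤ 1)
    (hl : 0 < l) (hs : 0 < s) (hln : l ≤ n) (hsn : s ≤ n) (hk : 0 < k) (hn : 1 < n)
    (hkn : (k : ℝ) ≤ (n : ℝ) ^ θ) (hr : 0 < r)
    (hratio : (Real.log n - 1) ^ 2 ≤ (k : ℝ) / l)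
    (hlog : θ / (1 + a) * Real.log n ≤ Real.log s - 2)
    (hM : (1 + a) ^ 4 * (2 * r / θ) ≤ M * l / k) (hθ : 0 < θ)
    (hc₁ : c₁ ≤ α ^ 2 * ((1 + a) ^ 2 * r)) (hc₂ : c₂ ≤ (1 - α) ^ 2 * ((1 + a) ^ 2 * r)) :
    l * Real.exp ((k / l : ℝ) * (Real.exp (a / 2) - 1) - a / 2 * ((1 + a) * (k / l : ℝ))) +
      (n * Real.exp (-(α ^ 2 *
        (M * weightSum n s ^ 2 / (2 * ((1 + a) * (k / l : ℝ)) * weightSqSum n s)))) +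
      k * Real.exp (-((1 - α) ^ 2 *
        (M * weightSum n s ^ 2 / (2 * ((1 + a) * (k / l : ℝ)) * weightSqSum n s))))) ≤
    n * Real.exp (-(a ^ 2 / 4 * (Real.log n - 1) ^ 2)) +
      ((n : ℝ) ^ (1 - c₁) + (n : ℝ) ^ (θ - c₂)) := by
  have hn0 : (0 : ℝ) < n := Nat.cast_pos.2 (by omega)
  have hk0 : (0 : ℝ) < k := Nat.cast_pos.2 hk
  have hl0 : (0 : ℝ) < l := Nat.cast_pos.2 hl
  have hlogn : 0 < Real.log n := Real.log_pos (by exact_mod_cast hn)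
  set μ : ℝ := (k : ℝ) / l with hμ
  have hμ0 : 0 < μ := by positivity
  set Γ : ℝ := M * weightSum n s ^ 2 / (2 * ((1 + a) * μ) * weightSqSum n s) with hΓ
  -- Of the four factors `1 + a` in `hM`, one pays for the imbalance of the blocks and one for the
  -- loss in `log s`; two remain as room for the threshold.
  have hΓ_le : (1 + a) ^ 2 * r * Real.log n ≤ Γ := by
    have h1 := log_sub_two_le_weight_ratio hs hsn
    have h2 : Γ = (M * l / k) * (weightSum n s ^ 2 / weightSqSum n s) / (2 * (1 + a)) := by
      rw [hΓ, hμ]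
      by_cases hV : weightSqSum n s = 0
      · simp [hV]
      · field_simp
    have h3 : 0 < θ / (1 + a) * Real.log n := by positivity
    rw [h2, le_div_iff₀ (by positivity)]
    calc (1 + a) ^ 2 * r * Real.log n * (2 * (1 + a)) =
        ((1 + a) ^ 4 * (2 * r / θ)) * (θ / (1 + a) * Real.log n) := by field_simp
      _ ≤ _ := mul_le_mul hM (hlog.trans h1) h3.le (le_trans (by positivity) hM)
  have hexp : ∀ {c γ : ℝ}, 0 ≤ γ → c ≤ γ * ((1 + a) ^ 2 * r) →
      Real.exp (-(γ * Γ)) ≤ (n : ℝ) ^ (-c) := by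
    intro c γ hγ hc
    rw [Real.rpow_def_of_pos hn0]
    refine Real.exp_le_exp.2 ?_
    have h1 := mul_le_mul_of_nonneg_left hΓ_le hγ
    have h2 := mul_le_mul_of_nonneg_right hc hlogn.le
    linarith
  have hb : μ * (Real.exp (a / 2) - 1) - a / 2 * ((1 + a) * μ) ≤
      -(a ^ 2 / 4 * (Real.log n - 1) ^ 2) := by
    -- The second-order error `(a / 2) ^ 2 * μ` is half of the gain `a ^ 2 / 2 * μ` from the
    -- deviation.
    have h1 := Real.abs_exp_sub_one_sub_id_le (x := a / 2) (by rw [abs_of_pos] <;> linarith)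
    have h2 := mul_le_mul_of_nonneg_left (le_of_abs_le h1) hμ0.le
    have h3 := mul_le_mul_of_nonneg_left hratio (show 0 ≤ a ^ 2 / 4 by positivity)
    have h4 : μ * (Real.exp (a / 2) - 1) - a / 2 * ((1 + a) * μ) =
      μ * (Real.exp (a / 2) - 1 - a / 2) - a ^ 2 / 2 * μ := by ring
    rw [h4]
    linarith
  refine add_le_add ?_ (add_le_add ?_ ?_)
  · exact mul_le_mul (Nat.cast_le.2 hln) (Real.exp_le_exp.2 hb) (Real.exp_pos _).le hn0.le
  · calc (n : ℝ) * Real.exp (-(α ^ 2 * Γ)) ≤ n * (n : ℝ) ^ (-c₁) :=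
          mul_le_mul_of_nonneg_left (hexp (sq_nonneg _) hc₁) hn0.le
      _ = (n : ℝ) ^ (1 - c₁) := by
          rw [sub_eq_add_neg, Real.rpow_add hn0, Real.rpow_one]
  · calc (k : ℝ) * Real.exp (-((1 - α) ^ 2 * Γ)) ≤ (n : ℝ) ^ θ * (n : ℝ) ^ (-c₂) :=
          mul_le_mul hkn (hexp (sq_nonneg _) hc₂) (Real.exp_pos _).le (by positivity)
      _ = (n : ℝ) ^ (θ - c₂) := by
          rw [sub_eq_add_neg, Real.rpow_add hn0]

/-- A rational threshold that separates the scores. -/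
theorem exists_threshold {u v w : ℝ} (hu : 0 < u) (hv : 0 < v) (hw : u + v < w) :
    ∃ p q : ℕ, p < q ∧ u ^ 2 < (p / q : ℝ) ^ 2 * w ^ 2 ∧ v ^ 2 < (1 - p / q : ℝ) ^ 2 * w ^ 2 := by
  have hw0 : 0 < w := by linarith
  obtain ⟨α, h1, h2⟩ := exists_rat_btwn (show u / w < 1 - v / w by
    rw [lt_sub_iff_add_lt, ← add_div, div_lt_one hw0]; exact hw)
  have hα0 : (0 : ℝ) < α := lt_trans (by positivity) h1
  have hvw : 0 < v / w := by positivity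
  have hα1 : (α : ℝ) < 1 := by linarith
  have hα0' : 0 < α := by exact_mod_cast hα0
  have hα1' : α < 1 := by exact_mod_cast hα1
  have hnum : (α.num.toNat : ℤ) = α.num := Int.toNat_of_nonneg (Rat.num_pos.2 hα0').le
  have hcast : ((α.num.toNat : ℝ) / (α.den : ℝ)) = (α : ℝ) := by
    have : (α.num.toNat : ℝ) = (α.num : ℝ) := by
      rw [← Int.cast_natCast, hnum]
    rw [this, ← Rat.cast_def]
  refine ⟨α.num.toNat, α.den, ?_, ?_, ?_⟩
  · have := Rat.num_lt_denom_iff.2 hα1'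
    omega
  · rw [hcast, ← mul_pow]
    rw [div_lt_iff₀ hw0] at h1
    exact pow_lt_pow_left₀ h1 hu.le two_ne_zero
  · rw [hcast, ← mul_pow]
    refine pow_lt_pow_left₀ ?_ hv.le two_ne_zero
    rw [← div_lt_iff₀ hw0]
    linarith

/-- For all large `n` there is a coupled scheme within the bound on the number of pools for which
the threshold decoder succeeds with high probability. -/
theorem eventually_exists_scheme {d p q : ℕ} (hpq : p < q) {θs : Fin d → ℝ} {θ a c₁ c₂ r : ℝ}
    (hθ0 : 0 < θ) (hθ1 : θ < 1) (hθs : ∀ i, θs i ≤ θ) (ha : 0 < a) (ha1 : a ≤ 1) (hr : 0 < r)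
    (hc₁ : c₁ ≤ (p / q : ℝ) ^ 2 * ((1 + a) ^ 2 * r))
    (hc₂ : c₂ ≤ (1 - p / q : ℝ) ^ 2 * ((1 + a) ^ 2 * r)) :
    ∀ᶠ n : ℕ in atTop, ∃ (m : ℕ) (𝒢 : PMF (PoolingScheme n m)),
      (m : ℝ) ≤ (1 + a) ^ 6 * (2 * r / θ) * labelCount θ n ∧
      1 - d * (n * Real.exp (-(a ^ 2 / 4 * (Real.log n - 1) ^ 2)) +
        ((n : ℝ) ^ (1 - c₁) + (n : ℝ) ^ (θ - c₂))) ≤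
        successProb θs 𝒢 (thresholdDecoder d p q) := by
  obtain ⟨L₀, hL₀⟩ := exists_design_parameters ha (show 0 < 2 * r / θ by positivity)
  have hlog : Tendsto (fun n : ℕ => Real.log n) atTop atTop :=
    Real.tendsto_log_atTop.comp tendsto_natCast_atTop_atTop
  have hθ' : θ / (1 + a) < θ := div_lt_self hθ0 (by linarith)
  -- This makes `d * k ≤ n`, so that ground truths exist.
  have hdk : ∀ᶠ n : ℕ in atTop, (d : ℝ) ≤ (n : ℝ) ^ (1 - θ) :=
    ((tendsto_rpow_atTop (by linarith)).comp
      tendsto_natCast_atTop_atTop).eventually_ge_atTop _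
  filter_upwards [eventually_le_labelCount hθ' (by positivity), hlog.eventually_ge_atTop (L₀ + 1),
    hlog.eventually_ge_atTop (Real.exp 2 + 1), eventually_gt_atTop 1, hdk]
    with n hkn hLn hLn' hn hd
  have hn0 : (0 : ℝ) < n := Nat.cast_pos.2 (by omega)
  have hn1 : (1 : ℝ) ≤ n := by exact_mod_cast hn.le
  set k := labelCount θ n with hk
  have he2 : 0 < Real.exp 2 := Real.exp_pos 2
  have hlog0 : 1 ≤ Real.log n := by linarith
  set L := ⌊Real.log n⌋₊ with hL
  have hLle : (L : ℝ) ≤ Real.log n := Nat.floor_le (by linarith)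
  have hLge : Real.log n - 1 ≤ L := (Nat.sub_one_lt_floor _).le
  have hL1 : 1 ≤ L := Nat.le_floor (by simpa using hlog0)
  have hLr : (0 : ℝ) < L := Nat.cast_pos.2 hL1
  have hpow1 : (1 : ℝ) ≤ (n : ℝ) ^ (θ / (1 + a)) := Real.one_le_rpow hn1 (by positivity)
  have hk_le : (k : ℝ) ≤ (n : ℝ) ^ θ := Nat.floor_le (by positivity)
  have hk4 : (L : ℝ) ^ 4 ≤ k := by
    refine le_trans ?_ hkn
    calc (L : ℝ) ^ 4 ≤ Real.log n ^ 4 := pow_le_pow_left₀ hLr.le hLle 4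
      _ ≤ _ := le_mul_of_one_le_left (by positivity) hpow1
  obtain ⟨l, s, M, hl, hs, hM, hlsk, hratio, hsge, hm, hMlk⟩ := hL₀ L
    (by have : (L₀ : ℝ) ≤ L := by linarith
        exact_mod_cast this) k (by exact_mod_cast hk4)
  have hkn' : d * k ≤ n := by
    have h1 : (d : ℝ) * k ≤ n := by
      calc (d : ℝ) * k ≤ (n : ℝ) ^ (1 - θ) * (n : ℝ) ^ θ := by gcongr
        _ = n := by rw [← Real.rpow_add hn0]; simp
    exact_mod_cast h1
  have hkn1 : k ≤ n := by
    have h1 : (k : ℝ) ≤ n := hk_le.trans (by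
      simpa using Real.rpow_le_rpow_of_exponent_le hn1 hθ1.le)
    exact_mod_cast h1
  have hk0 : 0 < k := by omega
  have hcount : ∀ i, labelCount (θs i) n ≤ k := fun i => labelCount_mono (hθs i) hn.le
  have hne : (groundTruths θs n).Nonempty := groundTruths_nonempty θs
    ((sum_le_card_nsmul _ _ _ fun i _ => hcount i).trans (by simpa using hkn'))
  have hlr : (0 : ℝ) < l := Nat.cast_pos.2 hl
  have hkr : (0 : ℝ) < k := Nat.cast_pos.2 hk0
  have hlogs : θ / (1 + a) * Real.log n ≤ Real.log s - 2 := by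
    -- Of the four logarithms in `hkn`, three pay for `L ^ 3`. The fourth exceeds `exp 2 + 1`, which
    -- covers the `2` subtracted from `log s` and the rounding of `s`.
    have h1 : Real.exp 2 * (n : ℝ) ^ (θ / (1 + a)) ≤ s := by
      refine le_trans ?_ hsge
      have h2 : (n : ℝ) ^ (θ / (1 + a)) * Real.log n ≤ k / (L : ℝ) ^ 3 := by
        rw [le_div_iff₀ (by positivity)]
        calc (n : ℝ) ^ (θ / (1 + a)) * Real.log n * (L : ℝ) ^ 3 ≤
            (n : ℝ) ^ (θ / (1 + a)) * Real.log n * Real.log n ^ 3 := by gcongr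
          _ = (n : ℝ) ^ (θ / (1 + a)) * Real.log n ^ 4 := by ring
          _ ≤ k := hkn
      have h3 := mul_le_mul_of_nonneg_left hLn' (zero_le_one.trans hpow1)
      linarith
    have h4 := Real.log_le_log (by positivity) h1
    rw [Real.log_mul he2.ne' (by positivity), Real.log_exp, Real.log_rpow hn0] at h4
    linarith
  have hsq : (Real.log n - 1) ^ 2 ≤ (k : ℝ) / l :=
    (pow_le_pow_left₀ (by linarith) hLge 2).trans hratio
  have : NeZero l := ⟨hl.ne'⟩
  refine ⟨(l + s) * (M + 1) + 1, (PMF.uniformOfFintype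
    ((Fin n → Fin l) × (Fin ((l + s) * (M + 1) + 1) × Fin n → Bool))).map
      fun ω => coupledScheme n l s M ω.1 ω.2, hm, ?_⟩
  refine le_successProb θs _ _ hne fun σ hσ => ?_
  simp only [groundTruths, mem_filter, mem_univ, true_and] at hσ
  refine (card_decoding_failure_le hpq hs hM hl (by omega) (k := k)
    (κ := (1 + a) * ((k : ℝ) / l)) (μ := (k : ℝ) / l) (t := a / 2) (by positivity) (by positivity)
    (by rw [div_mul_cancel₀ _ hlr.ne']) σ fun i => (hσ i).trans_le (hcount i)).trans ?_
  refine mul_le_mul_of_nonneg_right (mul_le_mul_of_nonneg_left ?_ (Nat.cast_nonneg _))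
    (Nat.cast_nonneg _)
  exact failure_bound_le ha ha1 hl hs (by omega) (by omega) hk0 hn hk_le hr hsq hlogs hMlk hθ0
    hc₁ hc₂

end Main

end PooledData

theorem corollary2 (d : ℕ) (θs : Fin d → ℝ) (hθs : ∀ i, 0 < θs i ∧ θs i < 1)
    (θ : ℝ) (hθ : IsGreatest (Set.range θs) θ) (δ : ℝ) (hδ : 0 < δ) :
    ∃ (m : ℕ → ℕ) (𝒢 : ∀ n : ℕ, PMF (PooledData.PoolingScheme n (m n)))
      (A : PooledData.Decoder d),
      (∀ n : ℕ, (m n : ℝ) ≤ (1 + δ) * ((1 + √θ) / (1 - √θ)) * PooledData.mInf θ n) ∧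
      PooledData.PolyTime A ∧
      Tendsto (fun n : ℕ => PooledData.successProb θs (𝒢 n) A) atTop (𝓝 1) := by
  obtain ⟨⟨i₀, hi₀⟩, hub⟩ := hθ
  have hθ0 : 0 < θ := hi₀ ▸ (hθs i₀).1
  have hθ1 : θ < 1 := hi₀ ▸ (hθs i₀).2
  have hle : ∀ i, θs i ≤ θ := fun i => hub ⟨i, rfl⟩
  have hsq0 : 0 < √θ := Real.sqrt_pos.2 hθ0
  have hsq : √θ ^ 2 = θ := Real.sq_sqrt hθ0.le
  have hsq1 : √θ < 1 := by nlinarith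
  -- `63 = 2 ^ 6 - 1`: powers of `a ≤ 1` are at most `a`, so `(1 + a) ^ 6 ≤ 1 + 63 * a`.
  set a : ℝ := min δ 1 / 63 with ha
  have hmin : 0 < min δ 1 := lt_min hδ one_pos
  have ha0 : 0 < a := by positivity
  have ha63 : 63 * a ≤ δ := by rw [ha]; linarith [min_le_left δ 1]
  have ha1 : a ≤ 1 := by rw [ha]; linarith [min_le_right δ 1]
  have hpow : (1 + a) ^ 6 ≤ 1 + δ := by
    have h1 : ∀ j : ℕ, a ^ (j + 1) ≤ a := fun j => by
      rw [pow_succ]; exact mul_le_of_le_one_left ha0.le (pow_le_one₀ ha0.le ha1)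
    have h2 := h1 1
    have h3 := h1 2
    have h4 := h1 3
    have h5 := h1 4
    have h6 := h1 5
    norm_num at h2 h3 h4 h5 h6
    calc (1 + a) ^ 6 = 1 + 6 * a + 15 * a ^ 2 + 20 * a ^ 3 + 15 * a ^ 4 + 6 * a ^ 5 + a ^ 6 := by
          ring
      _ ≤ 1 + δ := by linarith
  -- At `r = (1 + √θ) ^ 2` both requirements on the threshold would hold only with equality; the
  -- factor `1 + a` makes them strict, so that `c₁ > 1` and `c₂ > θ` below.
  obtain ⟨p, q, hpq, hp, hq⟩ := PooledData.exists_threshold one_pos hsq0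
    (show 1 + √θ < (1 + a) * (1 + √θ) by nlinarith)
  rw [mul_pow] at hp hq
  rw [one_pow] at hp
  rw [hsq] at hq
  have hbound : ∀ n, (1 + δ) * ((1 + √θ) / (1 - √θ)) * PooledData.mInf θ n =
      (1 + δ) * (2 * (1 + √θ) ^ 2 / θ) * PooledData.labelCount θ n := by
    intro n
    have h1 : 1 - √θ ≠ 0 := by linarith
    have h2 : 1 - θ = (1 - √θ) * (1 + √θ) := by nlinarith
    rw [PooledData.mInf, h2]
    field_simp
  set c₁ := (p / q : ℝ) ^ 2 * ((1 + a) ^ 2 * (1 + √θ) ^ 2)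
  set c₂ := (1 - p / q : ℝ) ^ 2 * ((1 + a) ^ 2 * (1 + √θ) ^ 2)
  set η : ℕ → ℝ := fun n => d * (n * Real.exp (-(a ^ 2 / 4 * (Real.log n - 1) ^ 2)) +
        ((n : ℝ) ^ (1 - c₁) + (n : ℝ) ^ (θ - c₂))) with hη
  have hη0 : Tendsto η atTop (𝓝 0) := by
    have h1 := PooledData.tendsto_mul_exp_neg_sq (show 0 < a ^ 2 / 4 by positivity)
    have h2 := PooledData.tendsto_rpow_neg_nat (show 1 - c₁ < 0 by linarith)
    have h3 := PooledData.tendsto_rpow_neg_nat (show θ - c₂ < 0 by linarith)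
    simpa using (h1.add (h2.add h3)).const_mul (d : ℝ)
  have hev := PooledData.eventually_exists_scheme hpq hθ0 hθ1 hle ha0 ha1
    (show 0 < (1 + √θ) ^ 2 by positivity) (c₁ := c₁) (c₂ := c₂) le_rfl le_rfl
  have hall : ∀ n : ℕ, ∃ (m : ℕ) (𝒢 : PMF (PooledData.PoolingScheme n m)),
      (m : ℝ) ≤ (1 + δ) * ((1 + √θ) / (1 - √θ)) * PooledData.mInf θ n ∧
      ((∃ (m : ℕ) (𝒢 : PMF (PooledData.PoolingScheme n m)),
        (m : ℝ) ≤ (1 + a) ^ 6 * (2 * (1 + √θ) ^ 2 / θ) * PooledData.labelCount θ n ∧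
        1 - η n ≤ PooledData.successProb θs 𝒢 (PooledData.thresholdDecoder d p q)) →
        1 - η n ≤ PooledData.successProb θs 𝒢 (PooledData.thresholdDecoder d p q)) := by
    intro n
    by_cases h : ∃ (m : ℕ) (𝒢 : PMF (PooledData.PoolingScheme n m)),
        (m : ℝ) ≤ (1 + a) ^ 6 * (2 * (1 + √θ) ^ 2 / θ) * PooledData.labelCount θ n ∧
        1 - η n ≤ PooledData.successProb θs 𝒢 (PooledData.thresholdDecoder d p q)
    · obtain ⟨m, 𝒢, h1, h2⟩ := h
      refine ⟨m, 𝒢, h1.trans ?_, fun _ => h2⟩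
      rw [hbound]
      gcongr
    -- Only finitely many `n` end up here, and having no pools always respects the bound.
    · refine ⟨0, PMF.pure fun _ => ∅, ?_, fun h' => absurd h' h⟩
      rw [hbound, Nat.cast_zero]
      positivity
  choose m 𝒢 hm hsucc using hall
  refine ⟨m, 𝒢, PooledData.thresholdDecoder d p q, hm,
    PooledData.polyTime_thresholdDecoder d p q, ?_⟩
  have hlim : Tendsto (fun n => 1 - η n) atTop (𝓝 1) := by simpa using hη0.const_sub 1
  refine tendsto_of_tendsto_of_tendsto_of_le_of_le' hlim tendsto_const_nhds ?_
    (Eventually.of_forall fun n => PooledData.successProb_le_one θs (𝒢 n) _)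
  filter_upwards [hev] with n hn
  exact hsucc n hn
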